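/- An \emph{(a,b)-module} is a free $\mathbb{C}[[b]]$-module $E$ of finite type together with a $\mathbb{C}$-linear endomorphism $a$, continuous for the $b$-adic topology, such that $ab-ba=b^2$. A morphism is a $\mathbb{C}[[b]]$-linear map commuting with $a$. $E$ has a \emph{simple pole} if $aE\subset bE$. The \emph{saturation} $E^\sharp$ is the smallest $\mathbb{C}[[b]]$-submodule of $E[b^{-1}]$ which contains $E$ and is stable under $b^{-1}a$, and $E$ is \emph{regular} if $E^\sharp$ is finitely generated over $\mathbb{C}[[b]]$. $E^b$ denotes the biggest simple pole sub-(a,b)-module of $E$. Let $\tilde{\mathcal A}=\{\sum_{n\ge 0} b^nP_n(a)\;:\;P_n\in\mathbb{C}[z]\}$ be the $\mathbb{C}$-algebra with $ab-ba=b^2$ (left and right multiplication by $a$ being continuous for the $b$-adic topology), and let $\theta$ be its $b$-adically continuous anti-automorphism with $\theta(a)=a$, $\theta(b)=-b$. Every (a,b)-module is a left $\tilde{\mathcal A}$-module. The \emph{dual} of an (a,b)-module $E$ is $E^*=\mathrm{Ext}^1_{\tilde{\mathcal A}}(E,\tilde{\mathcal A})$, on which $x\in\tilde{\mathcal A}$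 acts through the map $y\mapsto y\,\theta(x)$ of $\tilde{\mathcal A}$; a morphism $f:E\to F$ induces $f^*:F^*\to E^*$. For (a,b)-modules $E,F$, let $\mathrm{Hom}_{a,b}(E,F)$ be the group of $\mathbb{C}[[b]]$-linear maps $E\to F$, on which $S(b)\in\mathbb{C}[[b]]$ acts as multiplication by $S(-b)$ and $a$ acts by $(a\varphi)(e)=\varphi(ae)-a\varphi(e)$. Let $E_0=\tilde{\mathcal A}/\tilde{\mathcal A}a$, i.e. $E_0=\mathbb{C}[[b]]e_0$ with $ae_0=0$. \textbf{Proposition.} \begin{enumerate} \item For every (a,b)-module $E$, $E^*$ is an (a,b)-module, and there is an isomorphism of (a,b)-modules $E^*\simeq \mathrm{Hom}_{a,b}(E,E_0)$, functorial in $E$. \item For every exact sequence of (a,b)-modules $0\to E'\xrightarrow{u}E\xrightarrow{v}E''\to 0$, the sequence $0\to (E'')^*\xrightarrow{v^*}E^*\xrightarrow{u^*}(E')^*\to 0$ is exact. \item If $E$ has a simple pole, then $E^*$ has a simple pole. \item If $E$ is regular, then $E^*$ is regular, and there are isomorphisms of (a,b)-modules $$(E^\sharp)^*\simeq (E^*)^b\qquad\text{and}\qquad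 (E^b)^*\simeq (E^*)^\sharp .$$ \end{enumerate} -/

import Mathlib

open scoped Polynomial PowerSeries

namespace ABModule

noncomputable section

/-! ### Operators `A`, `B` with `A B - B A = B ^ 2` on a `B`-adically complete space -/

section Operators

variable {E : Type} [AddCommGroup E] [Module ℂ E]

/-- `E` is separated and complete for the filtration by the subspaces `B ^ N E`. -/
structure IsCompleteFor (B : Module.End ℂ E) : Prop where
  sep : ∀ y : E, (∀ N : ℕ, y ∈ LinearMap.range (B ^ N)) → y = 0
  lim : ∀ f : ℕ → E, ∃ y : E, ∀ N : ℕ,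
    y - ∑ n ∈ Finset.range N, (B ^ n) (f n) ∈ LinearMap.range (B ^ N)

/-- The sum `∑ n, B ^ n (f n)` of the `B`-adically convergent series. -/
def IsCompleteFor.sum {B : Module.End ℂ E} (hB : IsCompleteFor B) (f : ℕ → E) : E :=
  (hB.lim f).choose

theorem IsCompleteFor.sum_spec {B : Module.End ℂ E} (hB : IsCompleteFor B) (f : ℕ → E) (N : ℕ) :
    hB.sum f - ∑ n ∈ Finset.range N, (B ^ n) (f n) ∈ LinearMap.range (B ^ N) :=
  (hB.lim f).choose_spec N

theorem IsCompleteFor.eq_sum {B : Module.End ℂ E} (hB : IsCompleteFor B) (f : ℕ → E) (y : E)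
    (h : ∀ N : ℕ, y - ∑ n ∈ Finset.range N, (B ^ n) (f n) ∈ LinearMap.range (B ^ N)) :
    y = hB.sum f := by
  rw [← sub_eq_zero]
  refine hB.sep _ fun N => ?_
  have := Submodule.sub_mem _ (h N) (hB.sum_spec f N)
  simpa using this

theorem comm_pow {A B : Module.End ℂ E} (hAB : A * B = B * A + B ^ 2) (n : ℕ) :
    A * B ^ n = B ^ n * A + n • B ^ (n + 1) := by
  induction n with
  | zero => simp
  | succ n ih =>
    rw [pow_succ, ← mul_assoc, ih, add_mul, mul_assoc, hAB, mul_add, add_smul, one_smul,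
      smul_mul_assoc]
    simp only [← mul_assoc, ← pow_succ, ← pow_add]
    abel

/-- `P(A) B ^ n = ∑ k, n (n + 1) ⋯ (n + k - 1) / k! • B ^ (n + k) P⁽ᵏ⁾(A)`, up to `B ^ (n + K)`. -/
theorem aeval_comm_pow {A B : Module.End ℂ E} (hAB : A * B = B * A + B ^ 2) (P : ℂ[X]) (n K : ℕ) :
    ∃ R : Module.End ℂ E, Polynomial.aeval A P * B ^ n =
      ∑ k ∈ Finset.range K, n.ascFactorial k • (B ^ (n + k) * Polynomial.aeval A (Polynomial.hasseDeriv k P)) +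
        B ^ (n + K) * R := by
  induction P using Polynomial.induction_on generalizing K with
  | C c =>
    rcases K with _ | K
    · exact ⟨Polynomial.aeval A (Polynomial.C c), by simp [Algebra.commutes]⟩
    · refine ⟨0, ?_⟩
      rw [Finset.sum_range_succ']
      rw [Finset.sum_eq_zero]
      · simp [Algebra.commutes]
      · intro k _
        rw [Polynomial.hasseDeriv_C _ _ (Nat.succ_pos k)]
        simp
  | add P Q hP hQ =>
    obtain ⟨R, hR⟩ := hP K
    obtain ⟨S, hS⟩ := hQ K
    refine ⟨R + S, ?_⟩
    rw [map_add, add_mul, hR, hS]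
    simp only [map_add, mul_add, smul_add, Finset.sum_add_distrib]
    abel
  | monomial j c ih =>
    obtain ⟨R, hR⟩ := ih K
    have e : (Polynomial.C c * Polynomial.X ^ (j + 1) : ℂ[X]) = Polynomial.X * (Polynomial.C c * Polynomial.X ^ j) := by ring
    rw [e]
    generalize (Polynomial.C c * Polynomial.X ^ j : ℂ[X]) = Q at hR ⊢
    have hd : ∀ k, Polynomial.hasseDeriv (k + 1) (Polynomial.X * Q) =
        Polynomial.X * Polynomial.hasseDeriv (k + 1) Q + Polynomial.hasseDeriv k Q := by
      intro k
      ext m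
      rcases m with _ | m
      · simp [Polynomial.hasseDeriv_coeff]
      · simp only [Polynomial.hasseDeriv_coeff, Polynomial.coeff_X_mul, Polynomial.coeff_add, ← add_assoc]
        rw [show m + 1 + k + 1 = (m + k + 1) + 1 by ring, show m + 1 + k = m + k + 1 by ring, Nat.choose_succ_succ]
        push_cast
        ring
    have hsplit : ∀ K, ∑ k ∈ Finset.range (K + 1), n.ascFactorial k •
          (B ^ (n + k) * Polynomial.aeval A (Polynomial.hasseDeriv k (Polynomial.X * Q))) =
        ∑ k ∈ Finset.range (K + 1), n.ascFactorial k •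
          (B ^ (n + k) * (A * Polynomial.aeval A (Polynomial.hasseDeriv k Q))) +
        ∑ k ∈ Finset.range K, n.ascFactorial (k + 1) •
          (B ^ (n + (k + 1)) * Polynomial.aeval A (Polynomial.hasseDeriv k Q)) := by
      intro K
      rw [Finset.sum_range_succ', Finset.sum_range_succ' _ K]
      simp only [hd, map_add, map_mul, Polynomial.aeval_X, mul_add, smul_add, Finset.sum_add_distrib,
        Polynomial.hasseDeriv_zero']
      abel
    have hmain : Polynomial.aeval A (Polynomial.X * Q) * B ^ n =
        ∑ k ∈ Finset.range K, n.ascFactorial k •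
          (B ^ (n + k) * (A * Polynomial.aeval A (Polynomial.hasseDeriv k Q))) +
        ∑ k ∈ Finset.range K, n.ascFactorial (k + 1) •
          (B ^ (n + (k + 1)) * Polynomial.aeval A (Polynomial.hasseDeriv k Q)) +
        B ^ (n + K) * (A * R + (n + K) • (B * R)) := by
      rw [map_mul, Polynomial.aeval_X, mul_assoc, hR, mul_add, Finset.mul_sum, ← Finset.sum_add_distrib]
      congr 1
      · refine Finset.sum_congr rfl fun k _ => ?_
        rw [mul_smul_comm, ← mul_assoc, comm_pow hAB, add_mul, smul_add, smul_mul_assoc, smul_smul,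
          Nat.ascFactorial_succ, mul_comm (n + k), mul_assoc]
        rfl
      · rw [← mul_assoc, comm_pow hAB, add_mul, mul_add, pow_succ]
        simp only [smul_mul_assoc, mul_smul_comm, mul_assoc]
    rcases K with _ | K
    · exact ⟨_, by simpa using hmain⟩
    · refine ⟨A * R + (n + (K + 1)) • (B * R) +
        n.ascFactorial (K + 1) • Polynomial.aeval A (Polynomial.hasseDeriv K Q), ?_⟩
      rw [hmain, hsplit, Finset.sum_range_succ (fun k => n.ascFactorial (k + 1) •
          (B ^ (n + (k + 1)) * Polynomial.aeval A (Polynomial.hasseDeriv k Q))), mul_add (B ^ (n + (K + 1))) (A * R + _) _,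
          mul_smul_comm (n.ascFactorial _)]
      abel

theorem aeval_mem_range {A B : Module.End ℂ E} (hAB : A * B = B * A + B ^ 2) (P : ℂ[X]) (N : ℕ)
    {y : E} (hy : y ∈ LinearMap.range (B ^ N)) : Polynomial.aeval A P y ∈ LinearMap.range (B ^ N) := by
  obtain ⟨z, rfl⟩ := hy
  obtain ⟨R, hR⟩ := aeval_comm_pow hAB P N 0
  refine ⟨R z, ?_⟩
  have := congrArg (fun T : Module.End ℂ E => T z) hR
  simpa using this.symm

theorem pow_mem_range (B : Module.End ℂ E) {n N : ℕ} (h : N ≤ n) (y : E) :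
    (B ^ n) y ∈ LinearMap.range (B ^ N) :=
  ⟨(B ^ (n - N)) y, by rw [← Module.End.mul_apply, ← pow_add, Nat.add_sub_cancel' h]⟩

theorem pow_map_mem_range (B : Module.End ℂ E) (n N : ℕ) {y : E}
    (hy : y ∈ LinearMap.range (B ^ N)) : (B ^ n) y ∈ LinearMap.range (B ^ N) := by
  obtain ⟨z, rfl⟩ := hy
  rw [← Module.End.mul_apply, ← pow_add]
  exact pow_mem_range B (Nat.le_add_left _ _) z

end Operators

/-! ### The algebra `Ã` -/

/-- Elements of the algebra `Ã`: the formal sums `∑ n, b ^ n P_n(a)` with polynomials `P_n`,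
represented by the sequence `n ↦ P_n`. -/
@[ext] structure Atilde : Type where
  /-- The polynomial `P_n` in `∑ n, b ^ n P_n(a)`. -/
  coeff : ℕ → ℂ[X]

namespace Atilde

instance : CoeFun Atilde (fun _ => ℕ → ℂ[X]) := ⟨coeff⟩
instance : Zero Atilde := ⟨⟨fun _ => 0⟩⟩
instance : Add Atilde := ⟨fun x y => ⟨fun n => x n + y n⟩⟩
instance : Neg Atilde := ⟨fun x => ⟨fun n => -x n⟩⟩
instance : Sub Atilde := ⟨fun x y => ⟨fun n => x n - y n⟩⟩
instance {R : Type} [SMul R ℂ[X]] : SMul R Atilde := ⟨fun r x => ⟨fun n => r • x n⟩⟩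

theorem coeff_injective : Function.Injective coeff := fun _ _ h => Atilde.ext h

instance : AddCommGroup Atilde :=
  coeff_injective.addCommGroup coeff rfl (fun _ _ => rfl) (fun _ => rfl) (fun _ _ => rfl)
    (fun _ _ => rfl) (fun _ _ => rfl)

/-- Taking coefficients, as an additive map. -/
def coeffHom : Atilde →+ (ℕ → ℂ[X]) where
  toFun := coeff
  map_zero' := rfl
  map_add' _ _ := rfl

instance : Module ℂ Atilde := coeff_injective.module ℂ coeffHom fun _ _ => rfl

theorem ext' {x y : Atilde} (h : ∀ n, x n = y n) : x = y := Atilde.ext (funext h)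
@[simp] theorem mk_apply (f : ℕ → ℂ[X]) (n : ℕ) : (Atilde.mk f) n = f n := rfl
@[simp] theorem zero_apply (n : ℕ) : (0 : Atilde) n = 0 := rfl
@[simp] theorem add_apply (x y : Atilde) (n : ℕ) : (x + y) n = x n + y n := rfl
@[simp] theorem sub_apply (x y : Atilde) (n : ℕ) : (x - y) n = x n - y n := rfl
@[simp] theorem neg_apply (x : Atilde) (n : ℕ) : (-x) n = - x n := rfl
@[simp] theorem smul_apply (c : ℂ) (x : Atilde) (n : ℕ) : (c • x) n = c • x n := rfl
@[simp] theorem sum_apply {ι : Type*} (s : Finset ι) (f : ι → Atilde) (n : ℕ) :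
    (∑ i ∈ s, f i) n = ∑ i ∈ s, f i n := by
  have := congrFun (map_sum coeffHom f s) n
  rwa [Finset.sum_apply] at this

/-- A polynomial in `a`, as an element of `Ã`. -/
def ofPoly (P : ℂ[X]) : Atilde := ⟨fun n => if n = 0 then P else 0⟩

/-- A power series in `b`, as an element of `Ã`. -/
def ofSeries (S : ℂ⟦X⟧) : Atilde := ⟨fun n => Polynomial.C (PowerSeries.coeff n S)⟩

instance : One Atilde := ⟨ofPoly 1⟩

/-- The product of `Ã`. The relation `a b - b a = b ^ 2` gives
`P(a) b ^ n = ∑ k, (n (n + 1) ⋯ (n + k - 1) / k!) b ^ (n + k) P⁽ᵏ⁾(a)`, so that the coefficient of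
`b ^ N` in `(∑ b ^ m P_m(a)) (∑ b ^ n Q_n(a))` is
`∑_{m + k + n = N} (n (n + 1) ⋯ (n + k - 1) / k!) P_m⁽ᵏ⁾ Q_n`. -/
instance : Mul Atilde := ⟨fun x y => ⟨fun N =>
  ∑ p ∈ Finset.HasAntidiagonal.antidiagonal N, ∑ q ∈ Finset.HasAntidiagonal.antidiagonal p.1,
    p.2.ascFactorial q.2 • (Polynomial.hasseDeriv q.2 (x q.1) * y p.2)⟩⟩

theorem mul_apply (x y : Atilde) (N : ℕ) : (x * y) N =
    ∑ p ∈ Finset.HasAntidiagonal.antidiagonal N, ∑ q ∈ Finset.HasAntidiagonal.antidiagonal p.1,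
      p.2.ascFactorial q.2 • (Polynomial.hasseDeriv q.2 (x q.1) * y p.2) := rfl

theorem one_apply (n : ℕ) : (1 : Atilde) n = if n = 0 then 1 else 0 := rfl

end Atilde

section Action

variable {E : Type} [AddCommGroup E] [Module ℂ E] {A B : Module.End ℂ E}

/-- The action `(∑ b ^ n P_n(a)) • e = ∑ B ^ n (P_n(A) e)` of `Ã`. -/
def act (A : Module.End ℂ E) (hB : IsCompleteFor B) (x : Atilde) (e : E) : E :=
  hB.sum fun n => Polynomial.aeval A (x n) e

theorem act_add (hB : IsCompleteFor B) (x : Atilde) (e f : E) :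
    act A hB x (e + f) = act A hB x e + act A hB x f := by
  symm
  refine hB.eq_sum _ _ fun N => ?_
  have := Submodule.add_mem _ (hB.sum_spec (fun n => Polynomial.aeval A (x n) e) N)
    (hB.sum_spec (fun n => Polynomial.aeval A (x n) f) N)
  simp only [map_add, Finset.sum_add_distrib]
  rwa [add_sub_add_comm]

theorem add_act (hB : IsCompleteFor B) (x y : Atilde) (e : E) :
    act A hB (x + y) e = act A hB x e + act A hB y e := by
  symm
  refine hB.eq_sum _ _ fun N => ?_
  have := Submodule.add_mem _ (hB.sum_spec (fun n => Polynomial.aeval A (x n) e) N)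
    (hB.sum_spec (fun n => Polynomial.aeval A (y n) e) N)
  simp only [Atilde.add_apply, map_add, LinearMap.add_apply, Finset.sum_add_distrib]
  rwa [add_sub_add_comm]

theorem act_zero (hB : IsCompleteFor B) (x : Atilde) : act A hB x 0 = 0 := by
  have := act_add (A := A) hB x 0 0
  simpa using this

theorem zero_act (hB : IsCompleteFor B) (e : E) : act A hB 0 e = 0 := by
  have := add_act (A := A) hB 0 0 e
  simpa using this

theorem act_ofPoly (hB : IsCompleteFor B) (P : ℂ[X]) (e : E) :
    act A hB (Atilde.ofPoly P) e = Polynomial.aeval A P e := by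
  symm
  refine hB.eq_sum _ _ fun N => ?_
  rcases N with _ | N
  · simp
  · rw [Finset.sum_range_succ', Finset.sum_eq_zero]
    · simp [Atilde.ofPoly]
    · intro k _
      simp [Atilde.ofPoly]

theorem one_act (hB : IsCompleteFor B) (e : E) : act A hB 1 e = e :=
  (act_ofPoly hB 1 e).trans (by simp)

theorem sum_lt_eq {M : Type*} [AddCommMonoid M] (g : ℕ → ℕ → ℕ → M) (N : ℕ)
    (hg : ∀ m n k, N ≤ m + n + k → g m n k = 0) :
    ∑ m ∈ Finset.range N, ∑ n ∈ Finset.range N, ∑ k ∈ Finset.range N, g m n k =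
    ∑ s ∈ Finset.range N, ∑ p ∈ Finset.HasAntidiagonal.antidiagonal s, ∑ q ∈ Finset.HasAntidiagonal.antidiagonal p.1,
      g q.1 p.2 q.2 := by
  have h2 : ∀ (f : ℕ → ℕ → M) (K : ℕ), (∀ i j, K ≤ i + j → f i j = 0) →
      ∑ i ∈ Finset.range K, ∑ j ∈ Finset.range K, f i j =
      ∑ s ∈ Finset.range K, ∑ p ∈ Finset.HasAntidiagonal.antidiagonal s, f p.1 p.2 := by
    intro f K hf
    rw [← Finset.sum_product', Finset.sum_sigma']
    rw [← Finset.sum_filter_of_ne (p := fun x : ℕ × ℕ => x.1 + x.2 < K)]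
    · symm
      refine Finset.sum_bij (fun x _ => x.2) ?_ ?_ ?_ ?_
      · rintro ⟨s, i, j⟩ h
        simp at h ⊢
        omega
      · rintro ⟨s, i, j⟩ h ⟨s', i', j'⟩ h' e
        simp at h h' e ⊢
        omega
      · rintro ⟨i, j⟩ h
        simp at h
        exact ⟨⟨i + j, i, j⟩, by simp; omega, rfl⟩
      · intros; rfl
    · rintro ⟨i, j⟩ _ h
      by_contra h'
      exact h (hf i j (not_lt.mp h'))
  calc _ = ∑ n ∈ Finset.range N, ∑ s ∈ Finset.range N, ∑ q ∈ Finset.HasAntidiagonal.antidiagonal s,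
        g q.1 n q.2 := by
        rw [Finset.sum_comm]
        refine Finset.sum_congr rfl fun n _ => ?_
        exact h2 (fun m k => g m n k) N fun i j h => hg _ _ _ (by omega)
    _ = ∑ s ∈ Finset.range N, ∑ n ∈ Finset.range N, ∑ q ∈ Finset.HasAntidiagonal.antidiagonal s,
        g q.1 n q.2 := Finset.sum_comm
    _ = _ := by
        refine h2 (fun s n => ∑ q ∈ Finset.HasAntidiagonal.antidiagonal s, g q.1 n q.2) N fun i j h => ?_
        refine Finset.sum_eq_zero fun q hq => hg _ _ _ ?_
        rw [Finset.HasAntidiagonal.mem_antidiagonal] at hq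
        omega

theorem mul_act (hB : IsCompleteFor B) (hAB : A * B = B * A + B ^ 2) (x y : Atilde) (e : E) :
    act A hB (x * y) e = act A hB x (act A hB y e) := by
  symm
  refine hB.eq_sum _ _ fun N => ?_
  set F := LinearMap.range (B ^ N) with hF
  have key : ∀ u v : E, F.mkQ u = F.mkQ v ↔ u - v ∈ F := fun u v => by
    simp [Submodule.Quotient.eq]
  rw [← key]
  have hz : ∀ s z, N ≤ s → F.mkQ ((B ^ s) z) = 0 := fun s z h => by
    exact (Submodule.Quotient.mk_eq_zero F).2 (pow_mem_range B h z)
  have h1 : F.mkQ (act A hB x (act A hB y e)) =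
      ∑ m ∈ Finset.range N, F.mkQ ((B ^ m) (Polynomial.aeval A (x m) (act A hB y e))) := by
    rw [← map_sum, key]
    exact hB.sum_spec _ N
  have h2 : ∀ m, F.mkQ ((B ^ m) (Polynomial.aeval A (x m) (act A hB y e))) =
      ∑ n ∈ Finset.range N, F.mkQ ((B ^ m) (Polynomial.aeval A (x m) ((B ^ n) (Polynomial.aeval A (y n) e)))) := by
    intro m
    rw [← map_sum, ← map_sum, ← map_sum, key, ← map_sub, ← map_sub]
    exact pow_map_mem_range B m N (aeval_mem_range hAB _ N (hB.sum_spec _ N))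
  have h3 : ∀ m n, F.mkQ ((B ^ m) (Polynomial.aeval A (x m) ((B ^ n) (Polynomial.aeval A (y n) e)))) =
      ∑ k ∈ Finset.range N, F.mkQ (n.ascFactorial k •
        (B ^ (m + n + k)) (Polynomial.aeval A (Polynomial.hasseDeriv k (x m) * y n) e)) := by
    intro m n
    obtain ⟨R, hR⟩ := aeval_comm_pow hAB (x m) n N
    have hR' := congrArg (fun T : Module.End ℂ E => F.mkQ ((B ^ m) (T (Polynomial.aeval A (y n) e)))) hR
    simp only [Module.End.mul_apply, LinearMap.add_apply, LinearMap.sum_apply,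
      LinearMap.smul_apply, map_add, map_sum, map_nsmul] at hR'
    rw [hR', ← Module.End.mul_apply (B ^ m) (B ^ (n + N)), ← pow_add, hz _ _ (by omega), add_zero]
    refine Finset.sum_congr rfl fun k _ => ?_
    rw [map_nsmul, ← Module.End.mul_apply (B ^ m) (B ^ (n + k)), ← pow_add, ← add_assoc, map_mul,
      Module.End.mul_apply]
  rw [h1]
  simp only [h2, h3]
  rw [sum_lt_eq (fun m n k => F.mkQ (n.ascFactorial k •
        (B ^ (m + n + k)) (Polynomial.aeval A (Polynomial.hasseDeriv k (x m) * y n) e)))]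
  · rw [map_sum]
    refine Finset.sum_congr rfl fun s _ => ?_
    rw [Atilde.mul_apply]
    simp only [map_sum, LinearMap.sum_apply]
    refine Finset.sum_congr rfl fun p hp => Finset.sum_congr rfl fun q hq => ?_
    rw [Finset.HasAntidiagonal.mem_antidiagonal] at hp hq
    rw [show q.1 + p.2 + q.2 = s by omega]
    simp only [map_nsmul, LinearMap.smul_apply]
  · intro m n k h
    rw [map_nsmul, hz _ _ h, smul_zero]

end Action

namespace Atilde

/-- Left multiplication by `a`. -/
def leftA : Module.End ℂ Atilde where
  toFun x := ⟨fun n => Polynomial.X * x n + (n - 1) • x (n - 1)⟩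
  map_add' x y := by refine ext' fun n => ?_; simp only [add_apply, mul_add, smul_add]; abel
  map_smul' c x := by
    refine ext' fun n => ?_
    simp only [smul_apply, RingHom.id_apply, smul_add, mul_smul_comm]
    rw [smul_comm]

/-- Left multiplication by `b`. -/
def leftB : Module.End ℂ Atilde where
  toFun x := ⟨fun n => if n = 0 then 0 else x (n - 1)⟩
  map_add' x y := by refine ext' fun n => ?_; by_cases h : n = 0 <;> simp [h]
  map_smul' c x := by refine ext' fun n => ?_; by_cases h : n = 0 <;> simp [h]

theorem leftA_apply (x : Atilde) (n : ℕ) :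
    leftA x n = Polynomial.X * x n + (n - 1) • x (n - 1) := rfl

theorem leftB_zero (x : Atilde) : leftB x 0 = 0 := rfl
theorem leftB_succ (x : Atilde) (n : ℕ) : leftB x (n + 1) = x n := rfl

theorem left_comm : leftA * leftB = leftB * leftA + leftB ^ 2 := by
  refine LinearMap.ext fun x => ext' fun n => ?_
  rw [Module.End.mul_apply, LinearMap.add_apply, Module.End.mul_apply, pow_two,
    Module.End.mul_apply, add_apply, leftA_apply]
  rcases n with _ | _ | n
  · simp [leftB_zero]
  · simp [leftB_zero, leftB_succ, leftA_apply]
  · simp only [leftB_succ, leftA_apply, Nat.add_sub_cancel]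
    rw [add_smul, one_smul, add_assoc]

theorem leftB_pow_lt (N : ℕ) (x : Atilde) (n : ℕ) (h : n < N) : (leftB ^ N) x n = 0 := by
  induction N generalizing n with
  | zero => omega
  | succ N ih =>
    rw [pow_succ', Module.End.mul_apply]
    rcases n with _ | n
    · rfl
    · rw [leftB_succ]; exact ih n (by omega)

theorem leftB_pow_add (N : ℕ) (x : Atilde) (n : ℕ) : (leftB ^ N) x (N + n) = x n := by
  induction N with
  | zero => simp
  | succ N ih =>
    rw [pow_succ', Module.End.mul_apply, show N + 1 + n = (N + n) + 1 by ring, leftB_succ, ih]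

theorem mem_range_leftB (N : ℕ) (x : Atilde) :
    x ∈ LinearMap.range (leftB ^ N) ↔ ∀ n < N, x n = 0 := by
  constructor
  · rintro ⟨y, rfl⟩ n h
    exact leftB_pow_lt N y n h
  · intro h
    refine ⟨⟨fun n => x (N + n)⟩, ?_⟩
    refine ext' fun n => ?_
    by_cases hn : n < N
    · rw [leftB_pow_lt _ _ _ hn, h n hn]
    · obtain ⟨k, rfl⟩ := Nat.exists_eq_add_of_le (not_lt.mp hn)
      rw [leftB_pow_add]

theorem lim_aux (f : ℕ → Atilde) (hf : ∀ n s, s < n → f n s = 0) (N s : ℕ) (h : s < N) :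
    ∑ n ∈ Finset.range (s + 1), f n s = ∑ n ∈ Finset.range N, f n s := by
  refine Finset.sum_subset (fun i hi => ?_) fun i _ hi => ?_
  · simp at hi ⊢; omega
  · exact hf _ _ (by simpa using hi)

theorem leftB_complete : IsCompleteFor leftB where
  sep y hy := by
    refine ext' fun n => ?_
    exact (mem_range_leftB (n + 1) y).1 (hy (n + 1)) n (Nat.lt_succ_self n)
  lim f := by
    refine ⟨⟨fun s => ∑ n ∈ Finset.range (s + 1), (leftB ^ n) (f n) s⟩, fun N => ?_⟩
    rw [mem_range_leftB]
    intro s hs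
    rw [sub_apply, sum_apply, sub_eq_zero]
    exact lim_aux _ (fun n s h => leftB_pow_lt _ _ _ h) N s hs

theorem aeval_leftA (P Q : ℂ[X]) : Polynomial.aeval leftA P (ofPoly Q) = ofPoly (P * Q) := by
  induction P using Polynomial.induction_on generalizing Q with
  | C c =>
    refine ext' fun n => ?_
    by_cases h : n = 0 <;> simp [h, ofPoly, Polynomial.smul_eq_C_mul, Algebra.algebraMap_eq_smul_one]
  | add P R hP hR =>
    rw [map_add, LinearMap.add_apply, hP, hR]
    refine ext' fun n => ?_
    by_cases h : n = 0 <;> simp [h, ofPoly, add_mul]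
  | monomial j c ih =>
    rw [pow_succ, ← mul_assoc, map_mul, Module.End.mul_apply, Polynomial.aeval_X]
    have : leftA (ofPoly Q) = ofPoly (Polynomial.X * Q) := by
      refine ext' fun n => ?_
      rcases n with _ | _ | n <;> simp [leftA_apply, ofPoly]
    rw [this, ih, mul_assoc (Polynomial.C c * Polynomial.X ^ j)]

theorem act_one (x : Atilde) : act leftA leftB_complete x 1 = x := by
  symm
  refine leftB_complete.eq_sum _ _ fun N => ?_
  rw [mem_range_leftB]
  intro s hs
  have h1 : ∀ n, Polynomial.aeval leftA (x n) (1 : Atilde) = ofPoly (x n) := fun n =>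
    (aeval_leftA (x n) 1).trans (by rw [mul_one])
  simp only [h1]
  rw [sub_apply, sum_apply, Finset.sum_eq_single_of_mem s (Finset.mem_range.2 hs)]
  · have := leftB_pow_add s (ofPoly (x s)) 0
    rw [add_zero] at this
    rw [this]
    simp [ofPoly]
  · intro n _ hn
    rcases lt_or_gt_of_ne hn with h | h
    · obtain ⟨k, rfl⟩ := Nat.exists_eq_add_of_lt h
      rw [add_assoc, leftB_pow_add]
      rfl
    · exact leftB_pow_lt _ _ _ h

theorem mul_eq_act (x y : Atilde) : x * y = act leftA leftB_complete x y := by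
  rw [← act_one (x * y), mul_act leftB_complete left_comm, act_one]

instance : Ring Atilde :=
  { (inferInstance : AddCommGroup Atilde), (inferInstance : One Atilde),
    (inferInstance : Mul Atilde) with
    left_distrib := fun x y z => by simp only [mul_eq_act, act_add]
    right_distrib := fun x y z => by simp only [mul_eq_act, add_act]
    zero_mul := fun x => by rw [mul_eq_act, zero_act]
    mul_zero := fun x => by rw [mul_eq_act, act_zero]
    one_mul := fun x => by rw [mul_eq_act, one_act]
    mul_one := fun x => by rw [mul_eq_act, act_one]
    mul_assoc := fun x y z => by
      rw [mul_eq_act (x * y) z, mul_act leftB_complete left_comm, ← mul_eq_act, ← mul_eq_act] }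

/-- The generator `a` of `Ã`. -/
def a : Atilde := ofPoly Polynomial.X

/-- The generator `b` of `Ã`. -/
def b : Atilde := ofSeries PowerSeries.X

theorem a_mul (x : Atilde) : a * x = leftA x := by
  rw [mul_eq_act, a, act_ofPoly, Polynomial.aeval_X]

theorem b_eq : b = leftB 1 := by
  refine ext' fun n => ?_
  rcases n with _ | _ | n <;>
    simp [b, ofSeries, leftB_zero, leftB_succ, one_apply, PowerSeries.coeff_X]

theorem leftB_mul (x y : Atilde) : leftB (x * y) = leftB x * y := by
  refine ext' fun n => ?_
  rcases n with _ | n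
  · simp [leftB_zero, mul_apply]
  · rw [leftB_succ, mul_apply, mul_apply]
    rw [Finset.Nat.antidiagonal_succ, Finset.sum_cons]
    simp only [Finset.sum_map]
    have h0 : ∀ q ∈ Finset.HasAntidiagonal.antidiagonal 0,
        (n + 1).ascFactorial q.2 • ((Polynomial.hasseDeriv q.2) (leftB x q.1) * y (n + 1)) = 0 := by
      rintro ⟨i, j⟩ h
      simp at h
      simp [h, leftB_zero]
    rw [Finset.sum_eq_zero h0, zero_add]
    refine Finset.sum_congr rfl fun p _ => ?_
    simp only [Function.Embedding.coe_prodMap, Prod.map, Function.Embedding.coeFn_mk,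
      Function.Embedding.refl_apply]
    rw [Nat.succ_eq_add_one, Finset.Nat.antidiagonal_succ, Finset.sum_cons]
    simp [leftB_zero, leftB_succ]

theorem b_mul (x : Atilde) : b * x = leftB x := by
  rw [b_eq, ← leftB_mul, one_mul]

/-- The defining relation of `Ã`. -/
theorem a_mul_b : a * b = b * a + b ^ 2 := by
  have h := congrArg (fun T : Module.End ℂ Atilde => T 1) left_comm
  simp only [pow_two, Module.End.mul_apply, LinearMap.add_apply, ← a_mul, ← b_mul, mul_one] at h
  rw [pow_two]
  exact h

theorem b_pow_mul (N : ℕ) (x : Atilde) : b ^ N * x = (leftB ^ N) x := by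
  induction N with
  | zero => simp
  | succ N ih => rw [pow_succ', pow_succ', mul_assoc, ih, b_mul, Module.End.mul_apply]

/-- Power series in `b` form a commutative subring of `Ã`. -/
def ofSeriesHom : ℂ⟦X⟧ →+* Atilde where
  toFun := ofSeries
  map_zero' := by refine ext' fun n => ?_; simp [ofSeries]
  map_one' := by refine ext' fun n => ?_; by_cases h : n = 0 <;> simp [ofSeries, one_apply, PowerSeries.coeff_one, h]
  map_add' S T := by refine ext' fun n => ?_; simp [ofSeries]
  map_mul' S T := by
    refine ext' fun N => ?_
    rw [mul_apply]
    simp only [ofSeries, PowerSeries.coeff_mul, map_sum]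
    refine Finset.sum_congr rfl fun p _ => ?_
    rw [Finset.sum_eq_single_of_mem (p.1, 0) (by simp)]
    · simp
    · rintro ⟨i, k⟩ h hne
      rw [Finset.HasAntidiagonal.mem_antidiagonal] at h
      have hk : 0 < k := by
        rcases Nat.eq_zero_or_pos k with rfl | hk
        · exact absurd (by simp at h; simp [h]) hne
        · exact hk
      simp [Polynomial.hasseDeriv_C _ _ hk]

theorem smul_mul (c : ℂ) (x y : Atilde) : (c • x) * y = c • (x * y) := by
  refine ext' fun N => ?_
  simp only [mul_apply, smul_apply, map_smul, Finset.smul_sum, smul_mul_assoc]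
  refine Finset.sum_congr rfl fun p _ => Finset.sum_congr rfl fun q _ => ?_
  rw [smul_comm]

theorem C_comm (c : ℂ) :
    a * ofSeriesHom (PowerSeries.C c) = ofSeriesHom (PowerSeries.C c) * a := by
  have h : ofSeriesHom (PowerSeries.C c) = c • 1 := by
    refine ext' fun n => ?_
    by_cases h : n = 0 <;>
      simp [ofSeriesHom, ofSeries, one_apply, h, PowerSeries.coeff_C, Polynomial.smul_eq_C_mul]
  rw [h, smul_mul, one_mul, a_mul, map_smul, ← a_mul, mul_one]

/-! #### The anti-automorphism `θ` -/

/-- The map `θ(∑ b ^ n P_n(a)) = ∑ P_n(a) (-b) ^ n`; only the terms with `n ≤ N` contribute to the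
coefficient of `b ^ N`. -/
def theta (x : Atilde) : Atilde :=
  ⟨fun N => ∑ n ∈ Finset.range (N + 1), (ofPoly (x n) * (-b) ^ n) N⟩

theorem mul_b_succ (x : Atilde) (s : ℕ) : (x * b) (s + 1) =
    ∑ q ∈ Finset.HasAntidiagonal.antidiagonal s, q.2.factorial • Polynomial.hasseDeriv q.2 (x q.1) := by
  rw [mul_apply, Finset.sum_eq_single_of_mem (s, 1) (by simp)]
  · simp [b, ofSeries, PowerSeries.coeff_X, Nat.one_ascFactorial]
  · rintro ⟨i, n⟩ h hne
    rw [Finset.HasAntidiagonal.mem_antidiagonal] at h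
    have hn : n ≠ 1 := by
      rintro rfl
      exact hne (by simp at h; simp [h])
    simp [b, ofSeries, PowerSeries.coeff_X, hn]

theorem mul_b_zero (x : Atilde) : (x * b) 0 = 0 := by
  simp [mul_apply, b, ofSeries]

/-- The coefficientwise derivative. -/
def dA (x : Atilde) : Atilde := ⟨fun n => Polynomial.hasseDeriv 1 (x n)⟩

theorem b_comm (x : Atilde) : b * x = (x - b * dA x) * b := by
  rw [sub_mul, mul_assoc, b_mul, b_mul, eq_sub_iff_add_eq]
  refine ext' fun n => ?_
  rw [add_apply]
  rcases n with _ | _ | n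
  · simp [leftB_zero, mul_b_zero]
  · simp [leftB_succ, mul_b_zero, mul_b_succ]
  · rw [leftB_succ, leftB_succ, mul_b_succ, mul_b_succ, Finset.Nat.antidiagonal_succ',
      Finset.sum_cons]
    simp only [Finset.sum_map, Function.Embedding.coe_prodMap, Prod.map,
      Function.Embedding.coeFn_mk, Function.Embedding.refl_apply]
    congr 1
    · simp
    · refine Finset.sum_congr rfl fun q _ => ?_
      have := congrArg (fun T : ℂ[X] →ₗ[ℂ] ℂ[X] => T (x q.1)) (Polynomial.hasseDeriv_comp (R := ℂ) q.2 1)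
      simp only [LinearMap.comp_apply, LinearMap.smul_apply] at this
      rw [dA, this, smul_smul, Nat.factorial_succ, Nat.succ_eq_add_one, Nat.choose_succ_self_right,
        mul_comm]

theorem b_pow_comm (N : ℕ) (x : Atilde) : ∃ y, b ^ N * x = y * b ^ N := by
  induction N generalizing x with
  | zero => exact ⟨x, by simp⟩
  | succ N ih =>
    obtain ⟨y, hy⟩ := ih (x - b * dA x)
    exact ⟨y, by rw [pow_succ, mul_assoc, b_comm, ← mul_assoc, hy, mul_assoc]⟩

theorem mul_b_pow (N : ℕ) (x : Atilde) : ∃ y, x * b ^ N = b ^ N * y := by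
  induction N generalizing x with
  | zero => exact ⟨x, by simp⟩
  | succ N ih =>
    have : x * b ∈ LinearMap.range (leftB ^ 1) := by
      rw [mem_range_leftB]
      intro n hn
      obtain rfl : n = 0 := by omega
      exact mul_b_zero x
    obtain ⟨z, hz⟩ := this
    rw [pow_one, ← b_mul] at hz
    obtain ⟨y, hy⟩ := ih z
    exact ⟨y, by rw [pow_succ', ← mul_assoc, ← hz, mul_assoc, hy, mul_assoc]⟩

/-- Right multiplication by `y`. -/
def rightMul (y : Atilde) : Module.End ℂ Atilde where
  toFun x := x * y
  map_add' _ _ := add_mul _ _ _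
  map_smul' _ _ := smul_mul _ _ _

theorem rightMul_apply (x y : Atilde) : rightMul y x = x * y := rfl

theorem rightMul_pow (y : Atilde) (N : ℕ) (x : Atilde) : (rightMul y ^ N) x = x * y ^ N := by
  induction N with
  | zero => simp
  | succ N ih => rw [pow_succ', Module.End.mul_apply, ih, rightMul_apply, pow_succ, mul_assoc]

theorem right_comm : rightMul a * rightMul (-b) =
    rightMul (-b) * rightMul a + rightMul (-b) ^ 2 := by
  refine LinearMap.ext fun x => ?_
  rw [LinearMap.add_apply, rightMul_pow]
  simp only [Module.End.mul_apply, rightMul_apply, mul_assoc, a_mul_b, neg_mul, mul_neg, mul_add,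
    neg_sq, neg_add]
  abel

theorem mem_range_rightMul (N : ℕ) (x : Atilde) :
    x ∈ LinearMap.range (rightMul (-b) ^ N) ↔ ∀ n < N, x n = 0 := by
  rw [← mem_range_leftB]
  constructor
  · rintro ⟨y, rfl⟩
    rw [rightMul_pow, neg_pow, ← mul_assoc]
    obtain ⟨z, hz⟩ := mul_b_pow N (y * (-1) ^ N)
    exact ⟨z, by rw [hz, b_pow_mul]⟩
  · rintro ⟨y, rfl⟩
    obtain ⟨z, hz⟩ := b_pow_comm N y
    refine ⟨z * (-1) ^ N, ?_⟩
    rw [rightMul_pow, neg_pow b, mul_assoc, ← mul_assoc ((-1) ^ N) ((-1) ^ N) (b ^ N), ← pow_add,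
      Even.neg_one_pow ⟨N, rfl⟩, one_mul, ← hz, b_pow_mul]

theorem mul_neg_b_pow_lt (x : Atilde) (n s : ℕ) (h : s < n) : (x * (-b) ^ n) s = 0 :=
  (mem_range_rightMul n _).1 ⟨x, rightMul_pow _ _ _⟩ s h

theorem rightMul_complete : IsCompleteFor (rightMul (-b)) where
  sep y hy := by
    refine ext' fun n => ?_
    exact (mem_range_rightMul (n + 1) y).1 (hy (n + 1)) n (Nat.lt_succ_self n)
  lim f := by
    refine ⟨⟨fun s => ∑ n ∈ Finset.range (s + 1), (f n * (-b) ^ n) s⟩, fun N => ?_⟩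
    rw [mem_range_rightMul]
    intro s hs
    rw [sub_apply, sum_apply, sub_eq_zero]
    simp only [rightMul_pow]
    exact lim_aux (fun n => f n * (-b) ^ n) (fun n s h => mul_neg_b_pow_lt _ _ _ h) N s hs

theorem ofPoly_mul (P Q : ℂ[X]) : ofPoly P * ofPoly Q = ofPoly (P * Q) := by
  rw [mul_eq_act, act_ofPoly, aeval_leftA]

theorem ofPoly_add (P Q : ℂ[X]) : ofPoly (P + Q) = ofPoly P + ofPoly Q := by
  refine ext' fun n => ?_
  by_cases h : n = 0 <;> simp [ofPoly, h]

theorem aeval_rightMul (P : ℂ[X]) (x : Atilde) :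
    Polynomial.aeval (rightMul a) P x = x * ofPoly P := by
  induction P using Polynomial.induction_on generalizing x with
  | C c =>
    have : ofPoly (Polynomial.C c) = ofSeriesHom (PowerSeries.C c) := by
      refine ext' fun n => ?_
      by_cases h : n = 0 <;> simp [ofPoly, ofSeriesHom, ofSeries, h, PowerSeries.coeff_C]
    rw [Polynomial.aeval_C, Algebra.algebraMap_eq_smul_one, LinearMap.smul_apply,
      Module.End.one_apply]
    refine ext' fun N => ?_
    rw [mul_apply, Finset.sum_eq_single_of_mem (N, 0) (by simp)]
    · rw [Finset.sum_eq_single_of_mem (N, 0) (by simp)]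
      · simp [ofPoly, Polynomial.smul_eq_C_mul, mul_comm]
      · rintro ⟨i, k⟩ h hne
        have hk : k ≠ 0 := by
          rintro rfl
          exact hne (by simpa using h)
        obtain ⟨k, rfl⟩ := Nat.exists_eq_succ_of_ne_zero hk
        simp [Nat.zero_ascFactorial]
    · rintro ⟨i, n⟩ h hne
      have hn : n ≠ 0 := by
        rintro rfl
        exact hne (by simpa using h)
      simp [ofPoly, hn]
  | add P R hP hR => rw [map_add, LinearMap.add_apply, hP, hR, ofPoly_add, mul_add]
  | monomial j c ih =>
    rw [pow_succ, ← mul_assoc, mul_comm, map_mul, Module.End.mul_apply, Polynomial.aeval_X, ih,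
      rightMul_apply, mul_assoc, a, ofPoly_mul, mul_comm]

theorem mul_theta (x z : Atilde) : z * theta x = act (rightMul a) rightMul_complete x z := by
  refine rightMul_complete.eq_sum _ _ fun N => ?_
  have h1 : theta x - ∑ n ∈ Finset.range N, ofPoly (x n) * (-b) ^ n ∈
      LinearMap.range (rightMul (-b) ^ N) := by
    rw [mem_range_rightMul]
    intro s hs
    rw [sub_apply, sum_apply, sub_eq_zero]
    exact lim_aux (fun n => ofPoly (x n) * (-b) ^ n) (fun n s h => mul_neg_b_pow_lt _ _ _ h) N s hs
  obtain ⟨w, hw⟩ := h1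
  refine ⟨z * w, ?_⟩
  rw [rightMul_pow] at hw ⊢
  simp only [rightMul_pow, aeval_rightMul]
  rw [mul_assoc, hw, mul_sub, Finset.mul_sum]
  simp only [mul_assoc]

theorem theta_eq_act (x : Atilde) : theta x = act (rightMul a) rightMul_complete x 1 := by
  rw [← mul_theta, one_mul]

theorem theta_one : theta 1 = 1 := by rw [theta_eq_act, one_act]

theorem theta_zero : theta 0 = 0 := by rw [theta_eq_act, zero_act]

theorem theta_add (x y : Atilde) : theta (x + y) = theta x + theta y := by
  simp only [theta_eq_act, add_act]

/-- `θ` reverses products. -/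
theorem theta_mul (x y : Atilde) : theta (x * y) = theta y * theta x := by
  rw [mul_theta, theta_eq_act (x * y), mul_act rightMul_complete right_comm, theta_eq_act y]

theorem theta_a : theta a = a := by
  rw [theta_eq_act]
  exact (act_ofPoly _ _ _).trans (by rw [Polynomial.aeval_X, rightMul_apply, one_mul])

theorem theta_b : theta b = -b := by
  rw [theta_eq_act]
  symm
  refine rightMul_complete.eq_sum _ _ fun N => ?_
  rcases N with _ | _ | N
  · simp
  · simp only [b, ofSeries, zero_add, Finset.range_one, Finset.sum_singleton]
    simp [PowerSeries.coeff_X]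
    exact ⟨-1, by simp [rightMul_apply]⟩
  · rw [Finset.sum_eq_single_of_mem 1 (by simp)]
    · simp [b, ofSeries, PowerSeries.coeff_X, rightMul_apply]
    · intro n _ hn
      simp [b, ofSeries, PowerSeries.coeff_X, hn]

end Atilde

/-! ### (a,b)-modules -/

/-- A `ℂ[[b]]`-module `E` with a `ℂ`-linear endomorphism `a` such that `a b - b a = b ^ 2`.
The variable of `ℂ⟦X⟧` is `b`. -/
class ABAction (E : Type) [AddCommGroup E] [Module ℂ⟦X⟧ E] where
  /-- The operator `a`. -/
  a : E →+ E
  a_C_smul : ∀ (c : ℂ) (e : E),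
    a ((PowerSeries.C c : ℂ⟦X⟧) • e) = (PowerSeries.C c : ℂ⟦X⟧) • a e
  a_X_smul : ∀ e : E,
    a ((PowerSeries.X : ℂ⟦X⟧) • e) =
      (PowerSeries.X : ℂ⟦X⟧) • a e + (PowerSeries.X ^ 2 : ℂ⟦X⟧) • e


section Scalars

variable {R M : Type} [CommRing R] [AddCommGroup M] [Module R M]

theorem scal_mul (S T u p q : R) (e f : M) :
    S • (T • f + (u * q) • e) + (u * p) • T • e = (S * T) • f + (u * (S * q + T * p)) • e := by
  module

theorem scal_add (S T u p q : R) (e f : M) :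
    S • f + (u * p) • e + (T • f + (u * q) • e) = (S + T) • f + (u * (p + q)) • e := by
  module

theorem scal_pow (n : ℕ) (x y z : R) (e f : M) (hz : x * y = z) :
    x • (y • f + ((n : R) * z) • e) + x ^ 2 • y • e = (x * y) • f + (((n + 1 : ℕ) : R) * (z * x)) • e := by
  subst hz
  push_cast
  module

theorem scal_cont (x y n : R) (e f : M) :
    x • f + (n * (x * y)) • e = x • (f + (n * y) • e) := by
  module

theorem scal_leib (p x T u p' x' T' : R) (e f g : M) :
    p • f + (u * p') • e + (x • g + (u * x') • T • e) -
      ((p + x * T) • f + (u * (p' + (x * T' + T * x'))) • e) = x • (g - T • f - (u * T') • e) := by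
  module

end Scalars

section Basic

variable (E : Type) [AddCommGroup E] [Module ℂ⟦X⟧ E]

/-- The `b`-adic topology. -/
abbrev bAdicTopology : TopologicalSpace E :=
  (Ideal.span {(PowerSeries.X : ℂ⟦X⟧)}).adicModuleTopology E

variable [ABAction E]

/-- `E` is an (a,b)-module: it is free of finite type over `ℂ[[b]]` and `a` is continuous for the
`b`-adic topology. -/
class IsABModule : Prop where
  free : Module.Free ℂ⟦X⟧ E
  finite : Module.Finite ℂ⟦X⟧ E
  continuous_a : @Continuous E E (bAdicTopology E) (bAdicTopology E) (ABAction.a : E →+ E)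

attribute [instance] IsABModule.free IsABModule.finite

/-- `E` has a simple pole: `a E ⊆ b E`. -/
def HasSimplePole : Prop :=
  ∀ x : E, ∃ y : E, ABAction.a x = (PowerSeries.X : ℂ⟦X⟧) • y

variable {E}

theorem a_X_pow_smul (n : ℕ) (e : E) : ABAction.a ((PowerSeries.X ^ n : ℂ⟦X⟧) • e) =
    (PowerSeries.X ^ n : ℂ⟦X⟧) • ABAction.a e +
      ((n : ℂ⟦X⟧) * PowerSeries.X ^ (n + 1) : ℂ⟦X⟧) • e := by
  induction n with
  | zero => simp
  | succ n ih =>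
    rw [pow_succ', mul_smul, ABAction.a_X_smul, ih, pow_succ _ (n + 1)]
    exact scal_pow n _ _ _ _ _ (pow_succ' _ _).symm

/-- `a S(b) = S(b) a + b ^ 2 S'(b)` on `E`. -/
def Leibniz (E : Type) [AddCommGroup E] [Module ℂ⟦X⟧ E] [ABAction E] (S : ℂ⟦X⟧) : Prop :=
  ∀ e : E, ABAction.a (S • e) =
    S • ABAction.a e + (PowerSeries.X ^ 2 * PowerSeries.derivative ℂ S) • e

theorem leibniz_mul {S T : ℂ⟦X⟧} (hS : Leibniz E S) (hT : Leibniz E T) : Leibniz E (S * T) := by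
  intro e
  rw [mul_smul, hS, hT, Derivation.leibniz]
  exact scal_mul _ _ _ _ _ _ _

theorem leibniz_add {S T : ℂ⟦X⟧} (hS : Leibniz E S) (hT : Leibniz E T) : Leibniz E (S + T) := by
  intro e
  rw [add_smul, map_add, hS, hT, map_add]
  exact scal_add _ _ _ _ _ _ _

theorem leibniz_C (c : ℂ) : Leibniz E (PowerSeries.C c) := by
  intro e
  rw [ABAction.a_C_smul, PowerSeries.derivative_C]
  simp

theorem leibniz_X : Leibniz E (PowerSeries.X : ℂ⟦X⟧) := by
  intro e
  rw [ABAction.a_X_smul, PowerSeries.derivative_X, mul_one]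

theorem leibniz_X_pow (n : ℕ) : Leibniz E (PowerSeries.X ^ n) := by
  induction n with
  | zero => simpa using leibniz_C (E := E) 1
  | succ n ih => rw [pow_succ]; exact leibniz_mul ih leibniz_X

theorem leibniz_poly (P : ℂ[X]) : Leibniz E (P : ℂ⟦X⟧) := by
  induction P using Polynomial.induction_on with
  | C c => rw [Polynomial.coe_C]; exact leibniz_C c
  | add P Q hP hQ => rw [Polynomial.coe_add]; exact leibniz_add hP hQ
  | monomial j c ih =>
    rw [pow_succ, ← mul_assoc, Polynomial.coe_mul, Polynomial.coe_X]
    exact leibniz_mul ih leibniz_X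

theorem leibniz_aux (N : ℕ) (P : ℂ[X]) (T : ℂ⟦X⟧) (e : E) :
    ABAction.a (((P : ℂ⟦X⟧) + PowerSeries.X ^ N * T) • e) -
      (((P : ℂ⟦X⟧) + PowerSeries.X ^ N * T) • ABAction.a e +
        (PowerSeries.X ^ 2 * PowerSeries.derivative ℂ ((P : ℂ⟦X⟧) + PowerSeries.X ^ N * T)) • e) =
    (PowerSeries.X ^ N : ℂ⟦X⟧) • (ABAction.a (T • e) - T • ABAction.a e -
      (PowerSeries.X ^ 2 * PowerSeries.derivative ℂ T) • e) := by
  rw [add_smul, map_add, leibniz_poly P e, mul_smul (PowerSeries.X ^ N) T e,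
    leibniz_X_pow N (T • e), map_add, Derivation.leibniz]
  exact scal_leib _ _ _ _ _ _ _ _ _ _

/-- The operator `a` is always continuous for the `b`-adic topology. -/
theorem continuous_a :
    @Continuous E E (bAdicTopology E) (bAdicTopology E) (ABAction.a : E →+ E) := by
  let : TopologicalSpace E := bAdicTopology E
  let : TopologicalSpace ℂ⟦X⟧ :=
    (Ideal.adic_basis (Ideal.span {(PowerSeries.X : ℂ⟦X⟧)})).topology
  let I : Ideal ℂ⟦X⟧ := Ideal.span {(PowerSeries.X : ℂ⟦X⟧)}
  let FB : AddGroupFilterBasis E := (I.ringFilterBasis.moduleFilterBasis (I.adic_module_basis E)).toAddGroupFilterBasis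
  have : IsTopologicalAddGroup E := FB.isTopologicalAddGroup
  refine continuous_of_continuousAt_zero (ABAction.a : E →+ E) ?_
  have hb := FB.nhds_zero_hasBasis
  have hI : ∀ n : ℕ, ∀ y : E, y ∈ I ^ n • (⊤ : Submodule ℂ⟦X⟧ E) ↔
      ∃ z : E, y = (PowerSeries.X ^ n : ℂ⟦X⟧) • z := by
    intro n y
    rw [Ideal.span_singleton_pow, Submodule.ideal_span_singleton_smul,
      Submodule.mem_smul_pointwise_iff_exists]
    simp [eq_comm]
  rw [ContinuousAt, map_zero]
  refine (hb.tendsto_iff hb).2 ?_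
  rintro _ ⟨n, rfl⟩
  refine ⟨_, ⟨n, rfl⟩, ?_⟩
  intro x hx
  obtain ⟨z, rfl⟩ := (hI n x).1 hx
  refine (hI n _).2 ⟨ABAction.a z + ((n : ℂ⟦X⟧) * PowerSeries.X) • z, ?_⟩
  rw [a_X_pow_smul, pow_succ]
  exact scal_cont _ _ _ _ _

end Basic

section Complete

variable (E : Type) [AddCommGroup E] [Module ℂ⟦X⟧ E]

/-- The `ℂ`-vector space underlying a `ℂ[[b]]`-module. -/
abbrev complexModule : Module ℂ E := Module.compHom E (PowerSeries.C : ℂ →+* ℂ⟦X⟧)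

attribute [local instance] complexModule

/-- The operator `b`. -/
def opB : Module.End ℂ E where
  toFun e := (PowerSeries.X : ℂ⟦X⟧) • e
  map_add' _ _ := smul_add _ _ _
  map_smul' c e := smul_comm (PowerSeries.X : ℂ⟦X⟧) (PowerSeries.C c : ℂ⟦X⟧) e

/-- The operator `a`. -/
def opA [ABAction E] : Module.End ℂ E where
  toFun e := ABAction.a e
  map_add' _ _ := map_add _ _ _
  map_smul' c e := ABAction.a_C_smul c e

variable {E}

theorem opA_opB [ABAction E] : opA E * opB E = opB E * opA E + opB E ^ 2 := by
  refine LinearMap.ext fun e => ?_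
  have h := ABAction.a_X_smul e
  rw [pow_two, mul_smul] at h
  exact h

theorem opB_pow (N : ℕ) (e : E) : (opB E ^ N) e = (PowerSeries.X ^ N : ℂ⟦X⟧) • e := by
  induction N with
  | zero => simp
  | succ N ih =>
    rw [pow_succ', Module.End.mul_apply, ih, pow_succ', mul_smul]
    rfl

theorem mem_range_opB (N : ℕ) (y : E) : y ∈ LinearMap.range (opB E ^ N) ↔
    ∃ z : E, y = (PowerSeries.X ^ N : ℂ⟦X⟧) • z := by
  constructor
  · rintro ⟨z, rfl⟩; exact ⟨z, opB_pow N z⟩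
  · rintro ⟨z, rfl⟩; exact ⟨z, opB_pow N z⟩

theorem opB_complete [Module.Free ℂ⟦X⟧ E] [Module.Finite ℂ⟦X⟧ E] : IsCompleteFor (opB E) := by
  let β := Module.Free.chooseBasis ℂ⟦X⟧ E
  constructor
  · intro y hy
    refine β.ext_elem fun i => ?_
    rw [map_zero, Finsupp.zero_apply]
    ext n
    obtain ⟨z, rfl⟩ := (mem_range_opB (n + 1) y).1 (hy (n + 1))
    rw [map_smul, Finsupp.smul_apply, smul_eq_mul, PowerSeries.coeff_X_pow_mul', if_neg (by omega)]
    simp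
  · intro f
    let c : Module.Free.ChooseBasisIndex ℂ⟦X⟧ E → ℂ⟦X⟧ := fun i => PowerSeries.mk fun s =>
      ∑ n ∈ Finset.range (s + 1), PowerSeries.coeff s
        ((PowerSeries.X ^ n : ℂ⟦X⟧) * β.repr (f n) i)
    refine ⟨∑ i, c i • β i, fun N => ?_⟩
    rw [mem_range_opB]
    have hd : ∀ i, ∃ d : ℂ⟦X⟧, c i - ∑ n ∈ Finset.range N,
        (PowerSeries.X ^ n : ℂ⟦X⟧) * β.repr (f n) i = PowerSeries.X ^ N * d := by
      intro i
      refine PowerSeries.X_pow_dvd_iff.2 fun s hs => ?_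
      rw [map_sub, PowerSeries.coeff_mk, map_sum, sub_eq_zero]
      refine Finset.sum_subset (fun j hj => ?_) fun j _ hj => ?_
      · simp at hj ⊢; omega
      · rw [PowerSeries.coeff_X_pow_mul', if_neg (by simpa using hj)]
    choose d hd using hd
    refine ⟨∑ i, d i • β i, ?_⟩
    have hf : ∀ n, (opB E ^ n) (f n) =
        ∑ i, ((PowerSeries.X ^ n : ℂ⟦X⟧) * β.repr (f n) i) • β i := by
      intro n
      rw [opB_pow]
      conv_lhs => rw [← β.sum_repr (f n)]
      simp only [Finset.smul_sum, mul_smul]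
    simp only [hf]
    rw [Finset.sum_comm, ← Finset.sum_sub_distrib, Finset.smul_sum]
    refine Finset.sum_congr rfl fun i _ => ?_
    rw [← Finset.sum_smul, ← sub_smul, hd, mul_smul]

variable [ABAction E] [IsABModule E]

theorem leibniz (S : ℂ⟦X⟧) : Leibniz E S := by
  intro e
  rw [← sub_eq_zero]
  refine (opB_complete (E := E)).sep _ fun N => ?_
  rw [mem_range_opB]
  obtain ⟨T, hT⟩ : (PowerSeries.X ^ N : ℂ⟦X⟧) ∣ S - (PowerSeries.trunc N S : ℂ[X]) := by
    refine PowerSeries.X_pow_dvd_iff.2 fun s hs => ?_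
    simp [PowerSeries.coeff_trunc, hs]
  obtain ⟨P, rfl⟩ : ∃ P : ℂ[X], S = (P : ℂ⟦X⟧) + PowerSeries.X ^ N * T :=
    ⟨PowerSeries.trunc N S, by rw [← hT]; ring⟩
  exact ⟨_, leibniz_aux N P T e⟩

variable (E)

/-- The left `Ã`-module attached to an (a,b)-module `E`:
`(∑ b ^ n P_n(a)) • e` is the sum of the `b`-adically convergent series `∑ b ^ n (P_n(a) e)`. -/
@[reducible] def atildeModule : Module Atilde E where
  smul x e := act (opA E) (opB_complete (E := E)) x e
  one_smul e := one_act _ e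
  mul_smul x y e := mul_act _ opA_opB x y e
  smul_zero x := act_zero _ x
  smul_add x e f := act_add _ x e f
  add_smul x y e := add_act _ x y e
  zero_smul e := zero_act _ e

/-- The left `Ã`-module attached to an (a,b)-module `E`, as an object of the category of left
`Ã`-modules. -/
def toAtilde : ModuleCat.{0} Atilde := @ModuleCat.of Atilde _ E _ (atildeModule E)

variable {E}

theorem act_a (e : E) : act (opA E) (opB_complete (E := E)) Atilde.a e = ABAction.a e := by
  refine (act_ofPoly _ _ _).trans ?_
  rw [Polynomial.aeval_X]
  rfl

theorem act_ofSeries (S : ℂ⟦X⟧) (e : E) :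
    act (opA E) (opB_complete (E := E)) (Atilde.ofSeries S) e = S • e := by
  symm
  refine IsCompleteFor.eq_sum _ _ _ fun N => ?_
  rw [mem_range_opB]
  obtain ⟨T, hT⟩ : (PowerSeries.X ^ N : ℂ⟦X⟧) ∣ S - (PowerSeries.trunc N S : ℂ[X]) := by
    refine PowerSeries.X_pow_dvd_iff.2 fun s hs => ?_
    simp [PowerSeries.coeff_trunc, hs]
  refine ⟨T • e, ?_⟩
  rw [← mul_smul, ← hT, sub_smul]
  congr 1
  have h1 : ((PowerSeries.trunc N S : ℂ[X]) : ℂ⟦X⟧) =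
      ∑ n ∈ Finset.range N, (PowerSeries.X ^ n * PowerSeries.C (PowerSeries.coeff n S) : ℂ⟦X⟧) := by
    ext m
    simp [PowerSeries.coeff_trunc, PowerSeries.coeff_X_pow]
  rw [h1, Finset.sum_smul]
  refine Finset.sum_congr rfl fun n _ => ?_
  rw [opB_pow, mul_smul]
  simp only [Atilde.ofSeries, Polynomial.aeval_C, Algebra.algebraMap_eq_smul_one]
  rfl

end Complete

/-! ### Morphisms -/

/-- An (a,b)-linear map: `ℂ[[b]]`-linear and commuting with `a`. -/
structure ABHom (E F : Type) [AddCommGroup E] [Module ℂ⟦X⟧ E] [ABAction E]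
    [AddCommGroup F] [Module ℂ⟦X⟧ F] [ABAction F] extends E →ₗ[ℂ⟦X⟧] F where
  map_a : ∀ e : E, toFun (ABAction.a e) = ABAction.a (toFun e)

/-- An isomorphism of `ℂ[[b]]`-modules commuting with `a`. -/
structure ABIso (E F : Type) [AddCommGroup E] [Module ℂ⟦X⟧ E] [ABAction E]
    [AddCommGroup F] [Module ℂ⟦X⟧ F] [ABAction F] extends E ≃ₗ[ℂ⟦X⟧] F where
  map_a : ∀ e : E, toFun (ABAction.a e) = ABAction.a (toFun e)

section Morphisms

variable {E F : Type} [AddCommGroup E] [Module ℂ⟦X⟧ E] [ABAction E]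
  [AddCommGroup F] [Module ℂ⟦X⟧ F] [ABAction F]

instance : CoeFun (ABHom E F) (fun _ => E → F) := ⟨fun f => f.toLinearMap⟩
instance : CoeFun (ABIso E F) (fun _ => E → F) := ⟨fun f => f.toLinearEquiv⟩

attribute [local instance] complexModule

theorem ABHom.map_act [IsABModule E] [IsABModule F] (f : ABHom E F) (x : Atilde) (e : E) :
    f (act (opA E) (opB_complete (E := E)) x e) =
      act (opA F) (opB_complete (E := F)) x (f e) := by
  have hP : ∀ (P : ℂ[X]) (e : E), f (Polynomial.aeval (opA E) P e) =
      Polynomial.aeval (opA F) P (f e) := by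
    intro P
    induction P using Polynomial.induction_on with
    | C c =>
      intro e
      rw [Polynomial.aeval_C, Polynomial.aeval_C]
      exact map_smul f.toLinearMap (PowerSeries.C c : ℂ⟦X⟧) e
    | add P Q hP hQ =>
      intro e
      rw [map_add, map_add, LinearMap.add_apply, LinearMap.add_apply, map_add, hP, hQ]
    | monomial j c ih =>
      intro e
      rw [pow_succ, ← mul_assoc, map_mul _ (Polynomial.C c * Polynomial.X ^ j),
        map_mul _ (Polynomial.C c * Polynomial.X ^ j), Module.End.mul_apply, Module.End.mul_apply,
        ih, Polynomial.aeval_X, Polynomial.aeval_X]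
      congr 1
      exact f.map_a e
  refine IsCompleteFor.eq_sum _ _ _ fun N => ?_
  obtain ⟨z, hz⟩ := (mem_range_opB N _).1
    ((opB_complete (E := E)).sum_spec (fun n => Polynomial.aeval (opA E) (x n) e) N)
  refine (mem_range_opB N _).2 ⟨f z, ?_⟩
  rw [← map_smul f.toLinearMap, ← hz, map_sub, map_sum]
  congr 1
  refine Finset.sum_congr rfl fun n _ => ?_
  rw [opB_pow, opB_pow, map_smul, hP]

/-- The `Ã`-linear map underlying an (a,b)-linear map. -/
def ABHom.toAtilde [IsABModule E] [IsABModule F] (f : ABHom E F) :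
    ABModule.toAtilde E ⟶ ABModule.toAtilde F :=
  letI := atildeModule E
  letI := atildeModule F
  ModuleCat.ofHom
    { toFun := f
      map_add' := map_add f.toLinearMap
      map_smul' := f.map_act }

end Morphisms

/-! ### The dual `E^* = Ext¹_Ã(E, Ã)` -/

section Dual

open CategoryTheory CategoryTheory.Abelian

/-- Right multiplication by `y`, as a morphism of left `Ã`-modules `Ã → Ã`. -/
def rightMulHom (y : Atilde) : ModuleCat.of Atilde Atilde ⟶ ModuleCat.of Atilde Atilde :=
  ModuleCat.ofHom (LinearMap.toSpanSingleton Atilde Atilde y)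

theorem rightMulHom_one : rightMulHom 1 = 𝟙 _ := by
  ext; simp [rightMulHom]

theorem rightMulHom_zero : rightMulHom 0 = 0 := by
  ext; simp [rightMulHom]

theorem rightMulHom_add (y z : Atilde) :
    rightMulHom (y + z) = rightMulHom y + rightMulHom z := by
  ext; simp [rightMulHom]

theorem rightMulHom_mul (y z : Atilde) :
    rightMulHom (y * z) = rightMulHom y ≫ rightMulHom z := by
  ext; simp [rightMulHom]

variable (E : Type) [AddCommGroup E] [Module ℂ⟦X⟧ E] [ABAction E] [IsABModule E]

/-- The dual `E^* = Ext¹_Ã(E, Ã)` of an (a,b)-module `E`. -/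
def Dual : Type := Ext.{0} (toAtilde E) (ModuleCat.of Atilde Atilde) 1

instance : AddCommGroup (Dual E) :=
  inferInstanceAs (AddCommGroup (Ext.{0} (toAtilde E) (ModuleCat.of Atilde Atilde) 1))

/-- The left `Ã`-module structure of `E^*` coming from the `θ`-structure `x ∗ y = y θ(x)` of `Ã`. -/
instance : Module Atilde (Dual E) where
  smul x ξ := Ext.comp (show Ext.{0} (toAtilde E) (ModuleCat.of Atilde Atilde) 1 from ξ)
    (Ext.mk₀ (rightMulHom (Atilde.theta x))) (add_zero 1)
  one_smul ξ := by
    change Ext.comp _ _ _ = _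
    rw [Atilde.theta_one, rightMulHom_one, Ext.comp_mk₀_id]
  mul_smul x y ξ := by
    change Ext.comp _ _ _ = Ext.comp (Ext.comp _ _ _) _ _
    rw [Atilde.theta_mul, rightMulHom_mul, ← Ext.mk₀_comp_mk₀,
      Ext.comp_assoc _ _ _ (add_zero 1) (add_zero 0) (by simp)]
  smul_zero x := Ext.zero_comp _ _ _ _ _
  smul_add x ξ η := Ext.add_comp _ _ _ _
  add_smul x y ξ := by
    change Ext.comp _ _ _ = Ext.comp _ _ _ + Ext.comp _ _ _
    rw [Atilde.theta_add, rightMulHom_add, Ext.mk₀_add, Ext.comp_add]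
    rfl
  zero_smul ξ := by
    change Ext.comp _ _ _ = 0
    rw [Atilde.theta_zero, rightMulHom_zero, Ext.mk₀_zero, Ext.comp_zero]

/-- `ℂ[[b]]` acts on `E^*` as a subring of `Ã`. -/
instance : Module ℂ⟦X⟧ (Dual E) := Module.compHom (Dual E) Atilde.ofSeriesHom

theorem Dual.series_smul (S : ℂ⟦X⟧) (ξ : Dual E) : S • ξ = Atilde.ofSeriesHom S • ξ := rfl

/-- `a` acts on `E^*` as an element of `Ã`. -/
instance : ABAction (Dual E) where
  a :=
    { toFun := fun ξ => Atilde.a • ξ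
      map_zero' := smul_zero _
      map_add' := smul_add _ }
  a_C_smul c ξ := by
    change Atilde.a • Atilde.ofSeriesHom _ • ξ = Atilde.ofSeriesHom _ • Atilde.a • ξ
    rw [← mul_smul, ← mul_smul, Atilde.C_comm]
  a_X_smul ξ := by
    change Atilde.a • Atilde.ofSeriesHom _ • ξ =
      Atilde.ofSeriesHom _ • Atilde.a • ξ + Atilde.ofSeriesHom _ • ξ
    rw [← mul_smul, ← mul_smul, ← add_smul, map_pow]
    congr 1
    exact Atilde.a_mul_b

theorem Dual.a_apply (ξ : Dual E) : ABAction.a ξ = Atilde.a • ξ := rfl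

variable {E} {F : Type} [AddCommGroup F] [Module ℂ⟦X⟧ F] [ABAction F] [IsABModule F]

/-- The dual `f^* : F^* → E^*` of an (a,b)-linear map `f : E → F`. -/
def Dual.map (f : ABHom E F) : ABHom (Dual F) (Dual E) where
  toFun ξ := Ext.comp (Ext.mk₀ f.toAtilde)
    (show Ext.{0} (toAtilde F) (ModuleCat.of Atilde Atilde) 1 from ξ) (zero_add 1)
  map_add' ξ η := Ext.comp_add _ _ _ _
  map_smul' S ξ := (Ext.comp_assoc _ _ _ (zero_add 1) (add_zero 1) (by simp)).symm
  map_a ξ := (Ext.comp_assoc _ _ _ (zero_add 1) (add_zero 1) (by simp)).symm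

end Dual

/-! ### `Hom_{a,b}(E, F)` and `E_0` -/

section HomAB

variable (E F : Type) [AddCommGroup E] [Module ℂ⟦X⟧ E] [ABAction E] [IsABModule E]
  [AddCommGroup F] [Module ℂ⟦X⟧ F] [ABAction F] [IsABModule F]

/-- The `ℂ[[b]]`-linear maps `E → F`, with `S(b)` acting as `S(-b)` and with
`(a φ)(e) = φ(a e) - a φ(e)`. -/
def HomAB : Type := E →ₗ[ℂ⟦X⟧] F

instance : AddCommGroup (HomAB E F) := inferInstanceAs (AddCommGroup (E →ₗ[ℂ⟦X⟧] F))

instance : Module ℂ⟦X⟧ (HomAB E F) :=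
  letI : Module ℂ⟦X⟧ (HomAB E F) := inferInstanceAs (Module ℂ⟦X⟧ (E →ₗ[ℂ⟦X⟧] F))
  Module.compHom (HomAB E F) (PowerSeries.evalNegHom : ℂ⟦X⟧ →+* ℂ⟦X⟧)

variable {E F}

/-- A `ℂ[[b]]`-linear map, as an element of `Hom_{a,b}(E, F)`. -/
def HomAB.of (φ : E →ₗ[ℂ⟦X⟧] F) : HomAB E F := φ

/-- The `ℂ[[b]]`-linear map underlying an element of `Hom_{a,b}(E, F)`. -/
def HomAB.toLin (φ : HomAB E F) : E →ₗ[ℂ⟦X⟧] F := φ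

/-- The operator `Λ(φ)(e) = φ(a e) - a φ(e)`. -/
def HomAB.lam (φ : E →ₗ[ℂ⟦X⟧] F) : E →ₗ[ℂ⟦X⟧] F where
  toFun e := φ (ABAction.a e) - ABAction.a (φ e)
  map_add' e f := by simp only [map_add]; abel
  map_smul' S e := by
    rw [leibniz S e, map_add, map_smul, map_smul, map_smul, leibniz S (φ e), RingHom.id_apply,
      smul_sub]
    abel

instance : ABAction (HomAB E F) where
  a :=
    { toFun := fun φ => HomAB.of (HomAB.lam φ.toLin)
      map_zero' := LinearMap.ext fun e => by
        change (0 : F) - ABAction.a (0 : F) = 0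
        simp
      map_add' := fun φ ψ => LinearMap.ext fun e => by
        change φ.toLin _ + ψ.toLin _ - ABAction.a (φ.toLin e + ψ.toLin e) =
          (φ.toLin _ - ABAction.a (φ.toLin e)) + (ψ.toLin _ - ABAction.a (ψ.toLin e))
        rw [map_add]
        abel }
  a_C_smul c φ := LinearMap.ext fun e => by
    have h : PowerSeries.evalNegHom (PowerSeries.C c : ℂ⟦X⟧) = PowerSeries.C c := by
      ext n
      by_cases hn : n = 0 <;> simp [PowerSeries.evalNegHom, PowerSeries.coeff_C, hn]
    change PowerSeries.evalNegHom (PowerSeries.C c : ℂ⟦X⟧) • φ.toLin _ -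
        ABAction.a (PowerSeries.evalNegHom (PowerSeries.C c : ℂ⟦X⟧) • φ.toLin e) =
      PowerSeries.evalNegHom (PowerSeries.C c : ℂ⟦X⟧) • (φ.toLin _ - ABAction.a (φ.toLin e))
    rw [h, ABAction.a_C_smul, smul_sub]
  a_X_smul φ := LinearMap.ext fun e => by
    change PowerSeries.evalNegHom (PowerSeries.X : ℂ⟦X⟧) • φ.toLin _ -
        ABAction.a (PowerSeries.evalNegHom (PowerSeries.X : ℂ⟦X⟧) • φ.toLin e) =
      PowerSeries.evalNegHom (PowerSeries.X : ℂ⟦X⟧) • (φ.toLin _ - ABAction.a (φ.toLin e)) +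
        PowerSeries.evalNegHom (PowerSeries.X ^ 2 : ℂ⟦X⟧) • φ.toLin e
    rw [map_pow, PowerSeries.evalNegHom_X, neg_sq, neg_smul, neg_smul, neg_smul, map_neg,
      ABAction.a_X_smul, smul_sub]
    abel

/-- The (a,b)-module `E_0 = Ã / Ã a`: it is `ℂ[[b]] e` with `a e = 0`, so that
`a (S(b) e) = b ^ 2 S'(b) e`. -/
def E0 : Type := ℂ⟦X⟧

instance : AddCommGroup E0 := inferInstanceAs (AddCommGroup ℂ⟦X⟧)
instance : Module ℂ⟦X⟧ E0 := inferInstanceAs (Module ℂ⟦X⟧ ℂ⟦X⟧)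

/-- The operator `S ↦ b ^ 2 S'` on `ℂ[[b]]`. -/
def sqDeriv : ℂ⟦X⟧ →+ ℂ⟦X⟧ where
  toFun S := PowerSeries.X ^ 2 * PowerSeries.derivative ℂ S
  map_zero' := by rw [map_zero, mul_zero]
  map_add' S T := by rw [map_add, mul_add]

theorem sqDeriv_C_mul (c : ℂ) (S : ℂ⟦X⟧) :
    sqDeriv (PowerSeries.C c * S) = PowerSeries.C c * sqDeriv S := by
  change (PowerSeries.X ^ 2 * _ : ℂ⟦X⟧) = PowerSeries.C c * (PowerSeries.X ^ 2 * _)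
  rw [Derivation.leibniz, PowerSeries.derivative_C, smul_zero, add_zero, smul_eq_mul]
  ring

theorem sqDeriv_X_mul (S : ℂ⟦X⟧) :
    sqDeriv (PowerSeries.X * S) = PowerSeries.X * sqDeriv S + PowerSeries.X ^ 2 * S := by
  change (PowerSeries.X ^ 2 * _ : ℂ⟦X⟧) = PowerSeries.X * (PowerSeries.X ^ 2 * _) + _
  rw [Derivation.leibniz, PowerSeries.derivative_X, smul_eq_mul, smul_eq_mul]
  ring

instance : ABAction E0 where
  a := sqDeriv
  a_C_smul := sqDeriv_C_mul
  a_X_smul := sqDeriv_X_mul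

instance : IsABModule E0 where
  free := inferInstanceAs (Module.Free ℂ⟦X⟧ ℂ⟦X⟧)
  finite := inferInstanceAs (Module.Finite ℂ⟦X⟧ ℂ⟦X⟧)
  continuous_a := continuous_a

end HomAB

/-! ### `E^b`, `E[b⁻¹]`, `E^♯` and regularity -/

section Sub

variable {E : Type} [AddCommGroup E] [Module ℂ⟦X⟧ E] [ABAction E]

/-- The restriction of `a` to a sub-`ℂ[[b]]`-module stable under `a`. -/
@[reducible] def ABAction.restrict (N : Submodule ℂ⟦X⟧ E) (h : ∀ x ∈ N, ABAction.a x ∈ N) : ABAction N where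
  a :=
    { toFun := fun x => ⟨ABAction.a (x : E), h _ x.2⟩
      map_zero' := Subtype.ext (map_zero _)
      map_add' := fun _ _ => Subtype.ext (map_add _ _ _) }
  a_C_smul c x := Subtype.ext (ABAction.a_C_smul c (x : E))
  a_X_smul x := Subtype.ext (ABAction.a_X_smul (x : E))

/-- `F` is a sub-(a,b)-module with a simple pole: `a F ⊆ b F` (so that `a F ⊆ F`). -/
def IsSimplePoleSub (F : Submodule ℂ⟦X⟧ E) : Prop :=
  ∀ x ∈ F, ∃ y ∈ F, ABAction.a x = (PowerSeries.X : ℂ⟦X⟧) • y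

variable (E) in
/-- The biggest simple pole sub-(a,b)-module `E^b` of `E`. -/
def flat : Submodule ℂ⟦X⟧ E := sSup {F | IsSimplePoleSub F}

theorem isSimplePoleSub_flat : IsSimplePoleSub (flat E) := by
  intro x hx
  rw [flat, sSup_eq_iSup'] at hx
  induction hx using Submodule.iSup_induction' with
  | mem F x hx =>
    obtain ⟨y, hy, e⟩ := F.2 x hx
    exact ⟨y, le_sSup F.2 hy, e⟩
  | zero => exact ⟨0, zero_mem _, by simp⟩
  | add x x' _ _ h h' =>
    obtain ⟨y, hy, e⟩ := h
    obtain ⟨y', hy', e'⟩ := h'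
    exact ⟨y + y', add_mem hy hy', by rw [map_add, e, e', smul_add]⟩

/-- `E^b` is the biggest simple pole sub-(a,b)-module of `E`. -/
theorem isGreatest_flat : IsGreatest {F : Submodule ℂ⟦X⟧ E | IsSimplePoleSub F} (flat E) :=
  ⟨isSimplePoleSub_flat, fun _ hF => le_sSup hF⟩

theorem a_mem_flat (x : E) (hx : x ∈ flat E) : ABAction.a x ∈ flat E := by
  obtain ⟨y, hy, e⟩ := isSimplePoleSub_flat x hx
  rw [e]
  exact Submodule.smul_mem _ _ hy

variable (E) in
/-- `E^b`, as an (a,b)-module. -/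
abbrev Flat : Type := flat E

instance : ABAction (Flat E) := ABAction.restrict _ a_mem_flat

instance [IsABModule E] : IsABModule (Flat E) where
  free := inferInstance
  finite := inferInstance
  continuous_a := continuous_a

end Sub

section Sharp

section Scalars

variable {R M : Type} [CommRing R] [AddCommGroup M] [Module R M]

theorem scal_loc (z u s t du ds dt : R) (e f e' f' : M) (hu : u • t • e = u • s • f)
    (ha : (u * t) • e' + (z * (u * dt + t * du)) • e =
      (u * s) • f' + (z * (u * ds + s * du)) • f) :
    (u * u) • (t * t) • (s • e' - (z * ds) • e) = (u * u) • (s * s) • (t • f' - (z * dt) • f) := by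
  linear_combination (norm := module) (u * s * t) • ha - (z * (u * t * ds + s * t * du + u * s * dt)) • hu

theorem scal_loc_add (z s t ds dt : R) (e f e' f' : M) :
    (s * t) • (t • e' + (z * dt) • e + (s • f' + (z * ds) • f)) -
      (z * (s * dt + t * ds)) • (t • e + s • f) =
    (t * t) • (s • e' - (z * ds) • e) + (s * s) • (t • f' - (z * dt) • f) := by
  module

theorem scal_loc_X (x s z : R) (e e' : M) :
    s • (x • e' + x ^ 2 • e) - z • x • e = x • (s • e' - z • e) + (s * x ^ 2) • e := by
  module

theorem scal_loc_C (c s z : R) (e e' : M) :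
    s • c • e' - z • c • e = c • (s • e' - z • e) := by
  module

end Scalars

section Inverse

variable (E : Type) [AddCommGroup E] [Module ℂ⟦X⟧ E]

/-- `E[b⁻¹]`. -/
abbrev Loc : Type := LocalizedModule (Submonoid.powers (PowerSeries.X : ℂ⟦X⟧)) E

variable {E}

/-- The operator `b⁻¹` on `E[b⁻¹]`. -/
def bInv : Loc E →ₗ[ℂ⟦X⟧] Loc E :=
  LocalizedModule.divBy ⟨PowerSeries.X, Submonoid.mem_powers _⟩

theorem X_smul_bInv (x : Loc E) : (PowerSeries.X : ℂ⟦X⟧) • bInv x = x :=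
  LocalizedModule.mul_by_divBy (⟨PowerSeries.X, Submonoid.mem_powers _⟩ :
    Submonoid.powers (PowerSeries.X : ℂ⟦X⟧)) x

end Inverse

variable {E : Type} [AddCommGroup E] [Module ℂ⟦X⟧ E] [ABAction E]

theorem leibniz_powers (s : Submonoid.powers (PowerSeries.X : ℂ⟦X⟧)) : Leibniz E (s : ℂ⟦X⟧) := by
  obtain ⟨_, n, rfl⟩ := s
  exact leibniz_X_pow n

/-- The extension of `a` to `E[b⁻¹]`, given by `a (s⁻¹ e) = s⁻² (s (a e) - b ^ 2 s' e)` for every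
power `s` of `b`. -/
def locA (x : Loc E) : Loc E :=
  x.liftOn (fun p => LocalizedModule.mk
    ((p.2 : ℂ⟦X⟧) • ABAction.a p.1 -
      (PowerSeries.X ^ 2 * PowerSeries.derivative ℂ (p.2 : ℂ⟦X⟧)) • p.1) (p.2 * p.2)) (by
    rintro ⟨e, s⟩ ⟨f, t⟩ ⟨u, hu⟩
    refine LocalizedModule.mk_eq.2 ⟨u * u, ?_⟩
    refine scal_loc (PowerSeries.X ^ 2) (u : ℂ⟦X⟧) s t (PowerSeries.derivative ℂ (u : ℂ⟦X⟧)) _ _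
      e f _ _ hu ?_
    have h := congrArg (fun m : E => ABAction.a m) hu
    have h1 := leibniz_powers (E := E) (u * t) e
    have h2 := leibniz_powers (E := E) (u * s) f
    simp only [Submonoid.coe_mul, Derivation.leibniz, smul_eq_mul] at h1 h2
    rw [← h1, ← h2, mul_smul, mul_smul]
    exact h)

theorem locA_mk (e : E) (s : Submonoid.powers (PowerSeries.X : ℂ⟦X⟧)) :
    locA (LocalizedModule.mk e s) = LocalizedModule.mk ((s : ℂ⟦X⟧) • ABAction.a e -
      (PowerSeries.X ^ 2 * PowerSeries.derivative ℂ (s : ℂ⟦X⟧)) • e) (s * s) := rfl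

theorem locA_add (x y : Loc E) : locA (x + y) = locA x + locA y := by
  induction x, y using LocalizedModule.induction_on₂ with
  | _ e f s t =>
    rw [LocalizedModule.mk_add_mk, locA_mk, locA_mk, locA_mk, LocalizedModule.mk_add_mk,
      mul_mul_mul_comm]
    congr 1
    have h1 := leibniz_powers (E := E) t e
    have h2 := leibniz_powers (E := E) s f
    rw [map_add]
    simp only [Submonoid.smul_def, Submonoid.coe_mul, Derivation.leibniz, smul_eq_mul, h1, h2]
    exact scal_loc_add _ _ _ _ _ _ _ _ _

instance : ABAction (Loc E) where
  a := AddMonoidHom.mk' locA locA_add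
  a_C_smul c x := by
    induction x using LocalizedModule.induction_on with
    | _ e s =>
      change locA ((PowerSeries.C c : ℂ⟦X⟧) • LocalizedModule.mk e s) =
        (PowerSeries.C c : ℂ⟦X⟧) • locA (LocalizedModule.mk e s)
      rw [LocalizedModule.smul'_mk, locA_mk, locA_mk, LocalizedModule.smul'_mk, ABAction.a_C_smul]
      congr 1
      exact scal_loc_C _ _ _ _ _
  a_X_smul x := by
    induction x using LocalizedModule.induction_on with
    | _ e s =>
      have hadd : ∀ (m n : E) (t : Submonoid.powers (PowerSeries.X : ℂ⟦X⟧)),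
          LocalizedModule.mk (m + n) t = LocalizedModule.mk m t + LocalizedModule.mk n t := by
        intro m n t
        rw [LocalizedModule.mk_add_mk, ← smul_add, LocalizedModule.mk_cancel_common_left]
      change locA ((PowerSeries.X : ℂ⟦X⟧) • LocalizedModule.mk e s) =
        (PowerSeries.X : ℂ⟦X⟧) • locA (LocalizedModule.mk e s) +
          (PowerSeries.X ^ 2 : ℂ⟦X⟧) • LocalizedModule.mk e s
      rw [LocalizedModule.smul'_mk, locA_mk, locA_mk, LocalizedModule.smul'_mk, ABAction.a_X_smul,
        LocalizedModule.smul'_mk, ← LocalizedModule.mk_cancel_common_left s s, ← hadd]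
      congr 1
      rw [Submonoid.smul_def, ← mul_smul (s : ℂ⟦X⟧)]
      exact scal_loc_X _ _ _ _ _

variable (E) in
/-- The saturation `E^♯` of `E` by `b⁻¹ a` in `E[b⁻¹]`: the smallest `ℂ[[b]]`-submodule which
contains the image of `E` and is stable under `b⁻¹ a`. -/
def sharp : Submodule ℂ⟦X⟧ (Loc E) :=
  sInf {N | LinearMap.range (LocalizedModule.mkLinearMap _ E) ≤ N ∧
    ∀ x ∈ N, bInv (ABAction.a x) ∈ N}

theorem range_le_sharp :
    LinearMap.range (LocalizedModule.mkLinearMap (Submonoid.powers (PowerSeries.X : ℂ⟦X⟧)) E) ≤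
      sharp E :=
  le_sInf fun _ h => h.1

theorem bInv_a_mem_sharp (x : Loc E) (hx : x ∈ sharp E) : bInv (ABAction.a x) ∈ sharp E :=
  Submodule.mem_sInf.2 fun N hN => hN.2 x (Submodule.mem_sInf.1 hx N hN)

theorem a_mem_sharp (x : Loc E) (hx : x ∈ sharp E) : ABAction.a x ∈ sharp E := by
  rw [← X_smul_bInv (ABAction.a x)]
  exact Submodule.smul_mem _ _ (bInv_a_mem_sharp x hx)

variable (E)

/-- `E^♯`, with its operators `a` and `b`. -/
abbrev Sharp : Type := sharp E

instance : ABAction (Sharp E) := ABAction.restrict _ a_mem_sharp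

/-- `E` is regular: its saturation `E^♯` is finitely generated over `ℂ[[b]]`. -/
class IsRegularAB : Prop where
  fg : (sharp E).FG

/-- If `E` is regular, `E^♯` is an (a,b)-module. -/
instance [IsABModule E] [IsRegularAB E] : IsABModule (Sharp E) :=
  have hf : Module.Finite ℂ⟦X⟧ (sharp E) := Module.Finite.iff_fg.2 IsRegularAB.fg
  have ht : Module.IsTorsionFree ℂ⟦X⟧ (Loc E) := .of_smul_eq_zero fun r x hx => by
    induction x using LocalizedModule.induction_on with
    | _ e s =>
      rw [LocalizedModule.smul'_mk, ← LocalizedModule.zero_mk s, LocalizedModule.mk_eq] at hx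
      obtain ⟨u, hu⟩ := hx
      have hX : ∀ v : Submonoid.powers (PowerSeries.X : ℂ⟦X⟧), (v : ℂ⟦X⟧) ≠ 0 := by
        rintro ⟨_, n, rfl⟩
        exact pow_ne_zero _ PowerSeries.X_ne_zero
      rw [smul_zero, smul_zero] at hu
      rcases smul_eq_zero.1 ((smul_eq_zero.1 ((smul_eq_zero.1 hu).resolve_left (hX u))).resolve_left
        (hX s)) with h | h
      · exact Or.inl h
      · exact Or.inr (by rw [h, LocalizedModule.zero_mk])
  { free := inferInstance
    finite := hf
    continuous_a := continuous_a }

end Sharp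

end

end ABModule

open ABModule

namespace ABModule

noncomputable section

/-! ### Computations in `Ã` -/

namespace Atilde

/-! The proof computes `Ext¹` from a free resolution of length one, 0 → Ã ⊗ E → Ã ⊗ E → E → 0, the
tensor products being over ℂ[[b]]. The differential is D(x ⊗ e) = xa ⊗ e - x ⊗ ae and the
augmentation is x ⊗ e ↦ xe. In a basis of E in which a has matrix M, D sends a row vector x to xa -
xM. Everything rests on one division statement: each vector of Ã^ι is uniquely D(y) + v with v a
vector of power series in b (`exists_matD_add`, `matD_add_injective`). Modulo b this is division of
a polynomial vector in a by a - M(0), and b-adic completeness lifts it.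

Exactness of the resolution follows, so E^* is the space of ℂ[[b]]-linear maps E → Ã modulo the
coboundaries e ↦ a t(e) - t(ae). The anti-automorphism θ exchanges left and right multiplication. It
thus turns the division statement into its mirror image: every class has exactly one representative
with values in ℂ[[b]] (`exists_coboundary_add`, `form_eq_zero_of_coboundary`). This identifies E^*
with Hom(E, E_0). The series S acts through θ as S(-b). The identity φ(e)a = aφ(e) - b²φ(e)' shows
that a sends the class of φ to that of φ∘a - a∘φ (`formToAtilde_a`). Naturality of the extension
class gives functoriality.

The other assertions are then proved for Hom(-, E_0). Exactness holds because short exact sequences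
of free ℂ[[b]]-modules split. Simple poles are preserved because φ∘a - a∘φ is divisible by b when a
is, on both sides.

For E regular, restriction from E^♯ to E embeds (E^♯)^* in (E^*)^b. It is onto because the elements
of E[b⁻¹] on which all forms of (E^*)^b take values in E_0 make up a submodule containing E and
stable under b⁻¹a, hence containing E^♯ (`locMap_mem_of_mem_flat`). Regularity of E^* comes from the
embedding E^* → (E^b)^*, whose target has a simple pole. The second isomorphism is the first one for
E^*, dualised and combined with biduality (`bidualIso`). -/

theorem mul_zero_coeff (x y : Atilde) : (x * y) 0 = x 0 * y 0 := by
  simp [mul_apply]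

theorem mul_ofPoly_apply (x : Atilde) (P : ℂ[X]) (N : ℕ) : (x * ofPoly P) N = x N * P := by
  rw [mul_apply, Finset.sum_eq_single_of_mem (N, 0) (by simp)]
  · rw [Finset.sum_eq_single_of_mem (N, 0) (by simp)]
    · simp [ofPoly]
    · rintro ⟨i, k⟩ h hne
      have hk : k ≠ 0 := by
        rintro rfl
        exact hne (by simpa using h)
      obtain ⟨k, rfl⟩ := Nat.exists_eq_succ_of_ne_zero hk
      simp [Nat.zero_ascFactorial]
  · rintro ⟨i, n⟩ h hne
    have hn : n ≠ 0 := by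
      rintro rfl
      exact hne (by simpa using h)
    simp [ofPoly, hn]

theorem ofSeriesHom_apply (S : ℂ⟦X⟧) (n : ℕ) :
    ofSeriesHom S n = Polynomial.C (PowerSeries.coeff n S) := rfl

theorem ofSeriesHom_X : ofSeriesHom PowerSeries.X = b := rfl

theorem a_mul_ofSeriesHom (S : ℂ⟦X⟧) : a * ofSeriesHom S =
    ofSeriesHom S * a + ofSeriesHom (PowerSeries.X ^ 2 * PowerSeries.derivative ℂ S) := by
  refine ext' fun n => ?_
  rw [a_mul, leftA_apply, add_apply, a, mul_ofPoly_apply, mul_comm]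
  congr 1
  simp only [ofSeriesHom_apply]
  -- The factor `n - 1` is a truncated subtraction: it vanishes for n = 0 as well as for n = 1, in
  -- agreement with b²S' having no term below degree 2.
  rcases n with _ | _ | n
  · simp [PowerSeries.coeff_X_pow_mul']
  · simp [PowerSeries.coeff_X_pow_mul']
  · rw [PowerSeries.coeff_X_pow_mul', if_pos (by omega), show n + 1 + 1 - 2 = n by omega,
      PowerSeries.coeff_derivative]
    simp [mul_comm]

theorem ofPoly_C (c : ℂ) : ofPoly (Polynomial.C c) = ofSeriesHom (PowerSeries.C c) := by
  refine ext' fun n => ?_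
  by_cases h : n = 0 <;> simp [ofPoly, ofSeriesHom, ofSeries, h, PowerSeries.coeff_C]

/-- The constants commute with b, so the n-th summand of θ is the monomial c_n (-b)^n and only n = N
reaches the coefficient of b^N. -/
theorem theta_ofSeriesHom (S : ℂ⟦X⟧) :
    theta (ofSeriesHom S) = ofSeriesHom (PowerSeries.evalNegHom S) := by
  refine ext' fun N => ?_
  have h : ∀ n, ofPoly (ofSeriesHom S n) * (-b) ^ n =
      ofSeriesHom (PowerSeries.C (PowerSeries.coeff n S) * (-PowerSeries.X) ^ n) := fun n => by
    rw [ofSeriesHom_apply, ofPoly_C, map_mul, map_pow, map_neg, ofSeriesHom_X]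
  change ∑ n ∈ Finset.range (N + 1), (ofPoly (ofSeriesHom S n) * (-b) ^ n) N = _
  rw [Finset.sum_eq_single_of_mem N (by simp)]
  · rw [h, ofSeriesHom_apply, ofSeriesHom_apply, PowerSeries.coeff_C_mul, neg_pow,
      PowerSeries.evalNegHom, PowerSeries.coeff_rescale]
    congr 1
    rw [show ((-1 : ℂ⟦X⟧) ^ N) = PowerSeries.C ((-1) ^ N) by simp, PowerSeries.coeff_C_mul,
      PowerSeries.coeff_X_pow_self]
    ring
  · intro n _ hn
    rw [h, ofSeriesHom_apply, PowerSeries.coeff_C_mul, neg_pow,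
      show ((-1 : ℂ⟦X⟧) ^ n) = PowerSeries.C ((-1) ^ n) by simp, PowerSeries.coeff_C_mul,
      PowerSeries.coeff_X_pow, if_neg hn.symm]
    simp

/-- `θ`, as an additive map. -/
def thetaHom : Atilde →+ Atilde where
  toFun := theta
  map_zero' := theta_zero
  map_add' := theta_add

theorem theta_neg (x : Atilde) : theta (-x) = -theta x := map_neg thetaHom x

theorem theta_sub (x y : Atilde) : theta (x - y) = theta x - theta y := map_sub thetaHom x y

theorem theta_sum {κ : Type} (s : Finset κ) (f : κ → Atilde) :
    theta (∑ i ∈ s, f i) = ∑ i ∈ s, theta (f i) :=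
  map_sum thetaHom f s

theorem theta_pow (x : Atilde) (n : ℕ) : theta (x ^ n) = theta x ^ n := by
  induction n with
  | zero => simp [theta_one]
  | succ n ih => rw [pow_succ, theta_mul, ih, pow_succ']

theorem theta_ofPoly (P : ℂ[X]) : theta (ofPoly P) = ofPoly P := by
  rw [theta_eq_act, act_ofPoly, aeval_rightMul, one_mul]

theorem exists_eq_b_pow_mul {N : ℕ} {x : Atilde} (h : ∀ n < N, x n = 0) :
    ∃ y, x = b ^ N * y := by
  obtain ⟨y, hy⟩ := (mem_range_leftB N x).2 h
  exact ⟨y, by rw [b_pow_mul, hy]⟩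

theorem b_pow_mul_lt (x : Atilde) {n N : ℕ} (h : n < N) : (b ^ N * x) n = 0 := by
  rw [b_pow_mul, leftB_pow_lt _ _ _ h]

/-- Modulo b^(n+1), θ(x) is the finite sum of the P_m(a)(-b)^m, which θ sends back to the sum of the
b^m P_m(a). The involution property is what allows the division statement to be carried from right
to left multiplication. -/
theorem theta_theta (x : Atilde) : theta (theta x) = x := by
  have hN : ∀ N, (∃ y, theta x - ∑ n ∈ Finset.range N, ofPoly (x n) * (-b) ^ n = b ^ N * y) := by
    intro N
    refine exists_eq_b_pow_mul fun s hs => ?_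
    rw [sub_apply, sum_apply, sub_eq_zero]
    exact lim_aux (fun n => ofPoly (x n) * (-b) ^ n) (fun n s h => mul_neg_b_pow_lt _ _ _ h) N s hs
  refine ext' fun n => ?_
  obtain ⟨y, hy⟩ := hN (n + 1)
  have h1 : theta x = ∑ m ∈ Finset.range (n + 1), ofPoly (x m) * (-b) ^ m + b ^ (n + 1) * y := by
    rw [← hy]; abel
  -- θ puts the factor b^(n+1) of the remainder on the right; it has to be moved back to the left to
  -- see that coefficient n is unaffected.
  obtain ⟨z, hz⟩ := mul_b_pow (n + 1) (theta y * (-1) ^ (n + 1))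
  have h2 : theta (theta x) =
      ∑ m ∈ Finset.range (n + 1), b ^ m * ofPoly (x m) + b ^ (n + 1) * z := by
    rw [h1, theta_add, theta_mul (b ^ (n + 1)), theta_pow, theta_b, neg_pow b (n + 1),
      ← mul_assoc, hz, theta_sum]
    congr 1
    refine Finset.sum_congr rfl fun m _ => ?_
    rw [theta_mul, theta_ofPoly, theta_pow, theta_neg, theta_b, neg_neg]
  rw [h2, add_apply, b_pow_mul_lt _ (Nat.lt_succ_self n), add_zero, sum_apply,
    Finset.sum_eq_single_of_mem n (by simp)]
  · have := leftB_pow_add n (ofPoly (x n)) 0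
    rw [add_zero] at this
    rw [b_pow_mul, this]
    simp [ofPoly]
  · intro m hm hne
    obtain ⟨k, rfl⟩ := Nat.exists_eq_add_of_lt
      (lt_of_le_of_ne (Nat.lt_succ_iff.1 (Finset.mem_range.1 hm)) hne)
    rw [b_pow_mul, add_assoc, leftB_pow_add]
    rfl

end Atilde

/-! ### The basic bijection -/

section Matrix

variable {ι : Type}

/-- The coordinatewise embedding `ℂ[[b]] ^ ι → Ã ^ ι`. -/
def seriesVec : (ι → ℂ⟦X⟧) →ₛₗ[Atilde.ofSeriesHom] (ι → Atilde) where
  toFun v i := Atilde.ofSeriesHom (v i)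
  map_add' _ _ := funext fun _ => map_add _ _ _
  map_smul' _ _ := funext fun _ => map_mul _ _ _

theorem seriesVec_apply (v : ι → ℂ⟦X⟧) (i : ι) : seriesVec v i = Atilde.ofSeriesHom (v i) := rfl

theorem vec_eq_zero_of_b_pow {x : ι → Atilde} (h : ∀ N : ℕ, ∃ z, x = Atilde.b ^ N • z) : x = 0 := by
  funext i
  refine Atilde.ext' fun n => ?_
  obtain ⟨z, rfl⟩ := h (n + 1)
  exact Atilde.b_pow_mul_lt _ (Nat.lt_succ_self n)

theorem series_eq_zero_of_X_pow {v : ι → ℂ⟦X⟧}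
    (h : ∀ N : ℕ, ∃ w, v = (PowerSeries.X ^ N : ℂ⟦X⟧) • w) : v = 0 := by
  funext i
  ext n
  obtain ⟨w, rfl⟩ := h (n + 1)
  rw [Pi.smul_apply, smul_eq_mul, PowerSeries.coeff_X_pow_mul', if_neg (by omega)]
  simp

theorem b_smul_injective {x y : ι → Atilde} (h : Atilde.b • x = Atilde.b • y) : x = y := by
  funext i
  refine Atilde.ext' fun n => ?_
  have := congrArg (fun z : Atilde => z (n + 1)) (congrFun h i)
  simpa only [Pi.smul_apply, smul_eq_mul, Atilde.b_mul, Atilde.leftB_succ] using this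

/-- Only the remainders of the b-adic sum are recorded, since every later argument compares vectors
modulo b^N. -/
theorem exists_vec_lim (f : ℕ → ι → Atilde) : ∃ y : ι → Atilde, ∀ N : ℕ, ∃ z,
    y = ∑ n ∈ Finset.range N, Atilde.b ^ n • f n + Atilde.b ^ N • z := by
  choose y hy using fun i => Atilde.leftB_complete.lim fun n => f n i
  refine ⟨y, fun N => ?_⟩
  choose z hz using fun i => hy i N
  refine ⟨z, funext fun i => ?_⟩
  rw [Pi.add_apply, Finset.sum_apply, Pi.smul_apply, smul_eq_mul, Atilde.b_pow_mul, hz]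
  simp only [Pi.smul_apply, smul_eq_mul, Atilde.b_pow_mul]
  abel

variable [Fintype ι]

/-- This is uniqueness in the division by X - m. The coefficient of X^(n+1) in the relation
expresses the n-th coefficients of p through the (n+1)-st ones, so vanishing propagates downwards
from above the degrees. -/
theorem polynomial_eq_zero_of_mul_X (m : ι → ι → ℂ) (p : ι → ℂ[X]) (v : ι → ℂ)
    (h : ∀ i, p i * Polynomial.X - ∑ j, p j * Polynomial.C (m j i) + Polynomial.C (v i) = 0) :
    p = 0 ∧ v = 0 := by
  have hcoeff : ∀ n, (∀ i, (p i).coeff (n + 1) = 0) → ∀ i, (p i).coeff n = 0 := by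
    intro n hn i
    have := congrArg (fun q => Polynomial.coeff q (n + 1)) (h i)
    simpa [Polynomial.finsetSum_coeff, hn, Polynomial.coeff_C] using this
  -- The induction variable k bounds the distance from n up to the first index above all degrees.
  have hall : ∀ k n, Finset.univ.sup (fun i => (p i).natDegree) + 1 ≤ n + k →
      ∀ i, (p i).coeff n = 0 := by
    intro k
    induction k with
    | zero =>
      intro n hn i
      refine Polynomial.coeff_eq_zero_of_natDegree_lt ?_
      have := Finset.le_sup (f := fun i => (p i).natDegree) (Finset.mem_univ i)
      omega
    | succ k ih => exact fun n hn => hcoeff n (ih (n + 1) (by omega))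
  have hp : p = 0 := by
    ext i n
    exact hall _ n (Nat.le_add_left _ _) i
  refine ⟨hp, ?_⟩
  ext i
  have := h i
  simp only [hp, Pi.zero_apply, zero_mul, Finset.sum_const_zero, sub_zero, zero_add] at this
  exact Polynomial.C_eq_zero.1 this

/-- The map `x ↦ (x_i a - ∑ j, x_j M_{j i})_i`. -/
def matD (M : ι → ι → ℂ⟦X⟧) : (ι → Atilde) →ₗ[Atilde] (ι → Atilde) where
  toFun x i := x i * Atilde.a - ∑ j, x j * Atilde.ofSeriesHom (M j i)
  map_add' x y := funext fun i => by
    simp only [Pi.add_apply, add_mul, Finset.sum_add_distrib]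
    abel
  map_smul' c x := funext fun i => by
    simp only [Pi.smul_apply, smul_eq_mul, mul_assoc, RingHom.id_apply, mul_sub, Finset.mul_sum]

theorem matD_apply (M : ι → ι → ℂ⟦X⟧) (x : ι → Atilde) (i : ι) :
    matD M x i = x i * Atilde.a - ∑ j, x j * Atilde.ofSeriesHom (M j i) := rfl

theorem a_smul_seriesVec (M : ι → ι → ℂ⟦X⟧) (v : ι → ℂ⟦X⟧) :
    Atilde.a • seriesVec v = matD M (seriesVec v) + seriesVec (fun i => ∑ j, v j * M j i) +
      Atilde.b • seriesVec (fun i => PowerSeries.X * PowerSeries.derivative ℂ (v i)) := by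
  funext i
  simp only [Pi.smul_apply, Pi.add_apply, matD_apply, seriesVec_apply, smul_eq_mul,
    Atilde.a_mul_ofSeriesHom, map_sum, map_mul, pow_two, Atilde.ofSeriesHom_X, mul_assoc]
  abel

/-- Existence of the division modulo b. The vectors of this form are closed under addition and under
multiplication by a, and contain the constants and the multiples of b. Hence they contain all
polynomial vectors, and then everything. -/
theorem exists_matD_add_b (M : ι → ι → ℂ⟦X⟧) (x : ι → Atilde) :
    ∃ y v x', x = matD M y + seriesVec v + Atilde.b • x' := by
  classical
  let P : (ι → Atilde) → Prop := fun x => ∃ y v x', x = matD M y + seriesVec v + Atilde.b • x'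
  have hadd : ∀ x x', P x → P x' → P (x + x') := by
    rintro _ _ ⟨y, v, z, rfl⟩ ⟨y', v', z', rfl⟩
    exact ⟨y + y', v + v', z + z', by rw [map_add, map_add, smul_add]; abel⟩
  have hb : ∀ x, P (Atilde.b • x) := fun x => ⟨0, 0, x, by simp⟩
  have hs : ∀ v, P (seriesVec v) := fun v => ⟨0, v, 0, by simp⟩
  have hd : ∀ y, P (matD M y) := fun y => ⟨y, 0, 0, by simp⟩
  have ha : ∀ x, P x → P (Atilde.a • x) := by
    rintro _ ⟨y, v, z, rfl⟩
    -- Multiplying a series vector v by a gives D(v) + vM plus a multiple of b, and ab = ba + b²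
    -- keeps multiples of b among multiples of b.
    rw [smul_add, smul_add, ← map_smul, a_smul_seriesVec M]
    refine hadd _ _ (hadd _ _ (hd _) (hadd _ _ (hadd _ _ (hd _) (hs _)) (hb _))) ?_
    rw [← mul_smul, Atilde.a_mul_b, add_smul, mul_smul, pow_two, mul_smul]
    exact hadd _ _ (hb _) (hb _)
  have hsingle : ∀ i (Q : ℂ[X]), P (Pi.single i (Atilde.ofPoly Q)) := by
    intro i Q
    induction Q using Polynomial.induction_on with
    | C c =>
      convert hs (Pi.single i (PowerSeries.C c))
      funext j
      rw [seriesVec_apply, Atilde.ofPoly_C, Pi.single_apply, Pi.single_apply]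
      split_ifs <;> simp
    | add Q R hQ hR =>
      rw [Atilde.ofPoly_add, Pi.single_add]
      exact hadd _ _ hQ hR
    | monomial n c ih =>
      have := ha _ ih
      rw [← Pi.single_smul, smul_eq_mul, Atilde.a, Atilde.ofPoly_mul] at this
      rwa [show (Polynomial.C c * Polynomial.X ^ (n + 1) : ℂ[X]) =
        Polynomial.X * (Polynomial.C c * Polynomial.X ^ n) by ring]
  have hsum : ∀ (s : Finset ι) (f : ι → ι → Atilde), (∀ i ∈ s, P (f i)) → P (∑ i ∈ s, f i) :=
    fun s f hf => Finset.sum_induction _ P hadd (by simpa using hs 0) hf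
  -- An element of Ã is the polynomial P_0(a) plus a left multiple of b.
  have hx : ∀ i, ∃ z, x i = Atilde.ofPoly (x i 0) + Atilde.b * z := by
    intro i
    have : ∀ n < 1, (x i - Atilde.ofPoly (x i 0)) n = 0 := by
      intro n hn
      obtain rfl : n = 0 := by omega
      simp [Atilde.ofPoly]
    obtain ⟨z, hz⟩ := Atilde.exists_eq_b_pow_mul this
    exact ⟨z, by rw [pow_one] at hz; rw [← hz]; abel⟩
  choose z hz using hx
  have h := hadd _ _ (hsum Finset.univ (fun i => Pi.single i (Atilde.ofPoly (x i 0)))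
    fun i _ => hsingle i _) (hb z)
  convert h
  funext i
  rw [Finset.univ_sum_single]
  exact hz i

/-- Taking b⁰-coefficients is multiplicative, so modulo b the relation becomes a polynomial one with
the complex matrix M(0), and uniqueness of polynomial division applies. -/
theorem matD_add_eq_b (M : ι → ι → ℂ⟦X⟧) (y : ι → Atilde) (v : ι → ℂ⟦X⟧)
    (h : ∀ i, (matD M y + seriesVec v) i 0 = 0) :
    ∃ y' v', y = Atilde.b • y' ∧ v = (PowerSeries.X : ℂ⟦X⟧) • v' := by
  have h1 := polynomial_eq_zero_of_mul_X (fun i j => PowerSeries.coeff 0 (M i j))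
    (fun i => y i 0) (fun i => PowerSeries.coeff 0 (v i)) fun i => by
      have := h i
      rw [Pi.add_apply, Atilde.add_apply, matD_apply, Atilde.sub_apply, Atilde.sum_apply] at this
      simp only [Atilde.mul_zero_coeff, seriesVec_apply, Atilde.ofSeriesHom_apply] at this
      simpa [Atilde.a, Atilde.ofPoly] using this
  have hy : ∀ i, ∃ z, y i = Atilde.b * z := by
    intro i
    obtain ⟨z, hz⟩ := Atilde.exists_eq_b_pow_mul (N := 1) (x := y i) fun n hn => by
      obtain rfl : n = 0 := by omega
      exact congrFun h1.1 i
    exact ⟨z, by rwa [pow_one] at hz⟩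
  have hv : ∀ i, ∃ w, v i = PowerSeries.X * w := by
    intro i
    refine PowerSeries.X_dvd_iff.2 ?_
    have := congrFun h1.2 i
    simpa using this
  choose z hz using hy
  choose w hw using hv
  exact ⟨z, w, funext hz, funext hw⟩

/-- Both y and v are divisible by b, and the quotients satisfy the same relation because D is left
linear and left multiplication by b is injective. Iteration makes them divisible by every power of
b. -/
theorem matD_add_injective (M : ι → ι → ℂ⟦X⟧) (y : ι → Atilde) (v : ι → ℂ⟦X⟧)
    (h : matD M y + seriesVec v = 0) : y = 0 ∧ v = 0 := by
  have key : ∀ N : ℕ, ∃ y' v', y = Atilde.b ^ N • y' ∧ v = (PowerSeries.X ^ N : ℂ⟦X⟧) • v' ∧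
      matD M y' + seriesVec v' = 0 := by
    intro N
    induction N with
    | zero => exact ⟨y, v, by simp, by simp, h⟩
    | succ N ih =>
      obtain ⟨y', v', rfl, rfl, h'⟩ := ih
      obtain ⟨y'', v'', rfl, rfl⟩ := matD_add_eq_b M y' v' fun i => by rw [h']; rfl
      refine ⟨y'', v'', by rw [pow_succ, mul_smul], by rw [pow_succ, mul_smul], ?_⟩
      rw [map_smul, LinearMap.map_smulₛₗ, Atilde.ofSeriesHom_X, ← smul_add] at h'
      exact b_smul_injective (h'.trans (smul_zero _).symm)
  refine ⟨vec_eq_zero_of_b_pow fun N => ?_, series_eq_zero_of_X_pow fun N => ?_⟩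
  · obtain ⟨y', _, hy, _⟩ := key N
    exact ⟨y', hy⟩
  · obtain ⟨_, v', _, hv, _⟩ := key N
    exact ⟨v', hv⟩

theorem exists_series_lim (f : ℕ → ι → ℂ⟦X⟧) : ∃ v : ι → ℂ⟦X⟧, ∀ N : ℕ, ∃ w,
    v = ∑ n ∈ Finset.range N, (PowerSeries.X ^ n : ℂ⟦X⟧) • f n +
      (PowerSeries.X ^ N : ℂ⟦X⟧) • w := by
  let := complexModule (ι → ℂ⟦X⟧)
  obtain ⟨v, hv⟩ := (opB_complete (E := ι → ℂ⟦X⟧)).lim f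
  refine ⟨v, fun N => ?_⟩
  obtain ⟨w, hw⟩ := (mem_range_opB N _).1 (hv N)
  simp only [opB_pow] at hw
  exact ⟨w, by rw [← hw]; abel⟩

/-- Successive approximation: dividing modulo b, then dividing the cofactor T(x) of b in the same
way, produces the b-adic expansions of y and v. -/
theorem exists_matD_add (M : ι → ι → ℂ⟦X⟧) (x : ι → Atilde) :
    ∃ y v, x = matD M y + seriesVec v := by
  choose Y V T hT using exists_matD_add_b M
  obtain ⟨y, hy⟩ := exists_vec_lim fun n => Y (T^[n] x)
  obtain ⟨v, hv⟩ := exists_series_lim fun n => V (T^[n] x)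
  refine ⟨y, v, ?_⟩
  have hx : ∀ N : ℕ, x = matD M (∑ n ∈ Finset.range N, Atilde.b ^ n • Y (T^[n] x)) +
      seriesVec (∑ n ∈ Finset.range N, (PowerSeries.X ^ n : ℂ⟦X⟧) • V (T^[n] x)) +
      Atilde.b ^ N • T^[N] x := by
    intro N
    induction N with
    | zero => simp
    | succ N ih =>
      conv_lhs => rw [ih, hT (T^[N] x)]
      rw [Finset.sum_range_succ, Finset.sum_range_succ, map_add, map_add, map_smul (matD M),
        LinearMap.map_smulₛₗ, map_pow, Atilde.ofSeriesHom_X, Function.iterate_succ_apply', smul_add,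
        smul_add, pow_succ, mul_smul]
      abel
  rw [← sub_eq_zero]
  -- D and the embedding of series commute with b^N, so truncating y and v at order N changes the
  -- right-hand side only by a multiple of b^N.
  refine vec_eq_zero_of_b_pow fun N => ?_
  obtain ⟨z, hz⟩ := hy N
  obtain ⟨w, hw⟩ := hv N
  refine ⟨T^[N] x - matD M z - seriesVec w, ?_⟩
  conv_lhs => rw [hx N, hz, hw]
  rw [map_add (matD M), map_add seriesVec, map_smul (matD M) (Atilde.b ^ N),
    LinearMap.map_smulₛₗ seriesVec (PowerSeries.X ^ N),
    map_pow, Atilde.ofSeriesHom_X, smul_sub, smul_sub]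
  abel

/-! ### The division statement for left multiplication, obtained through θ. -/

theorem evalNegHom_evalNegHom (S : ℂ⟦X⟧) :
    PowerSeries.evalNegHom (PowerSeries.evalNegHom S) = S := by
  ext n
  rw [PowerSeries.evalNegHom, PowerSeries.coeff_rescale, PowerSeries.coeff_rescale, ← mul_assoc,
    ← mul_pow]
  simp

theorem theta_matD (M : ι → ι → ℂ⟦X⟧) (y : ι → Atilde) (v : ι → ℂ⟦X⟧) (i : ι) :
    Atilde.theta ((matD M y + seriesVec v) i) =
      Atilde.a * Atilde.theta (y i) -
        ∑ j, Atilde.ofSeriesHom (PowerSeries.evalNegHom (M j i)) * Atilde.theta (y j) +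
        Atilde.ofSeriesHom (PowerSeries.evalNegHom (v i)) := by
  rw [Pi.add_apply, Atilde.theta_add, matD_apply, Atilde.theta_sub, Atilde.theta_mul, Atilde.theta_a,
    Atilde.theta_sum, seriesVec_apply, Atilde.theta_ofSeriesHom]
  simp only [Atilde.theta_mul, Atilde.theta_ofSeriesHom]

/-- θ reverses products and replaces b by -b, so the right-hand division is applied to the transpose
of M with entries evaluated at -b; applying θ again restores M. -/
theorem exists_leftMat_add (M : ι → ι → ℂ⟦X⟧) (x : ι → Atilde) :
    ∃ (t : ι → Atilde) (v : ι → ℂ⟦X⟧), ∀ i, x i = Atilde.a * t i -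
      ∑ j, Atilde.ofSeriesHom (M i j) * t j + Atilde.ofSeriesHom (v i) := by
  obtain ⟨y, v, h⟩ := exists_matD_add (fun i j => PowerSeries.evalNegHom (M j i))
    fun i => Atilde.theta (x i)
  refine ⟨fun i => Atilde.theta (y i), fun i => PowerSeries.evalNegHom (v i), fun i => ?_⟩
  have := theta_matD (fun i j => PowerSeries.evalNegHom (M j i)) y v i
  rw [← h, Atilde.theta_theta] at this
  simpa only [evalNegHom_evalNegHom] using this

theorem leftMat_add_injective (M : ι → ι → ℂ⟦X⟧) (t : ι → Atilde) (v : ι → ℂ⟦X⟧)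
    (h : ∀ i, Atilde.a * t i - ∑ j, Atilde.ofSeriesHom (M i j) * t j +
      Atilde.ofSeriesHom (v i) = 0) : v = 0 := by
  have := (matD_add_injective (fun i j => PowerSeries.evalNegHom (M j i))
    (fun i => Atilde.theta (t i)) (fun i => PowerSeries.evalNegHom (v i)) ?_).2
  · funext i
    have := congrArg PowerSeries.evalNegHom (congrFun this i)
    rwa [evalNegHom_evalNegHom, Pi.zero_apply, map_zero] at this
  · funext i
    have e := theta_matD (fun i j => PowerSeries.evalNegHom (M j i))
      (fun i => Atilde.theta (t i)) (fun i => PowerSeries.evalNegHom (v i)) i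
    simp only [evalNegHom_evalNegHom, Atilde.theta_theta, h] at e
    rw [← Atilde.theta_theta ((_ + seriesVec _ : ι → Atilde) i), e]
    exact Atilde.theta_zero

end Matrix

/-! ### The free resolution of an (a,b)-module -/

/-- The underlying power series of an element of `E_0`. -/
def e0Equiv : E0 ≃ₗ[ℂ⟦X⟧] ℂ⟦X⟧ := LinearEquiv.refl ℂ⟦X⟧ ℂ⟦X⟧

theorem e0Equiv_a (x : E0) : e0Equiv (ABAction.a x) =
    PowerSeries.X ^ 2 * PowerSeries.derivative ℂ (e0Equiv x) := rfl

/-- The coordinates 0 and 1 of a standard basis vector commute with a, so multiplication by a may be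
written on the left, as in the basis-free description of D. -/
theorem matD_single {ι : Type} [Fintype ι] [DecidableEq ι] (M : ι → ι → ℂ⟦X⟧) (i : ι) :
    matD M (Pi.single i 1) = Atilde.a • Pi.single i 1 - seriesVec (M i) := by
  funext j
  have h1 : (Pi.single i 1 : ι → Atilde) j * Atilde.a = Atilde.a * (Pi.single i 1 : ι → Atilde) j := by
    by_cases h : j = i
    · rw [h, Pi.single_eq_same, one_mul, mul_one]
    · rw [Pi.single_eq_of_ne h, zero_mul, mul_zero]
  rw [matD_apply, Pi.sub_apply, Pi.smul_apply, seriesVec_apply, smul_eq_mul, h1,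
    Finset.sum_eq_single_of_mem i (Finset.mem_univ _), Pi.single_eq_same, one_mul]
  · intro k _ hk
    rw [Pi.single_eq_of_ne hk, zero_mul]

section Cover

variable (E : Type) [AddCommGroup E] [Module ℂ⟦X⟧ E] [ABAction E] [IsABModule E]

/-- The free `Ã`-module `Ã ⊗ E`, described by a basis of `E`. -/
abbrev Cover : Type := Module.Free.ChooseBasisIndex ℂ⟦X⟧ E → Atilde

/-- A basis of `E`. -/
abbrev basis : Module.Basis (Module.Free.ChooseBasisIndex ℂ⟦X⟧ E) ℂ⟦X⟧ E :=
  Module.Free.chooseBasis ℂ⟦X⟧ E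

/-- The map `e ↦ 1 ⊗ e`. -/
def toCover : E →ₛₗ[Atilde.ofSeriesHom] Cover E :=
  seriesVec.comp (basis E).equivFun.toLinearMap

variable {E}

theorem toCover_apply (e : E) (i : Module.Free.ChooseBasisIndex ℂ⟦X⟧ E) :
    toCover E e i = Atilde.ofSeriesHom ((basis E).repr e i) := rfl

theorem toCover_basis (i : Module.Free.ChooseBasisIndex ℂ⟦X⟧ E) 
    [DecidableEq (Module.Free.ChooseBasisIndex ℂ⟦X⟧ E)] :
    toCover E (basis E i) = Pi.single i 1 := by
  funext j
  rw [toCover_apply, Module.Basis.repr_self, Finsupp.single_apply, Pi.single_apply]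
  simp only [eq_comm (a := i)]
  split_ifs <;> simp

variable {N : Type} [AddCommGroup N] [Module Atilde N]

/-- The `Ã`-linear extension of a `ℂ[[b]]`-linear map. -/
def coverLift (φ : E →ₛₗ[Atilde.ofSeriesHom] N) : Cover E →ₗ[Atilde] N :=
  Fintype.linearCombination Atilde fun i => φ (basis E i)

theorem semilinear_apply (φ : E →ₛₗ[Atilde.ofSeriesHom] N) (e : E) :
    φ e = ∑ i, Atilde.ofSeriesHom ((basis E).repr e i) • φ (basis E i) := by
  conv_lhs => rw [← (basis E).sum_repr e, map_sum]
  simp only [LinearMap.map_smulₛₗ]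

theorem coverLift_toCover (φ : E →ₛₗ[Atilde.ofSeriesHom] N) (e : E) :
    coverLift φ (toCover E e) = φ e :=
  (semilinear_apply φ e).symm

/-- The elements 1 ⊗ e generate Ã ⊗ E; identities between maps out of it can thus be checked without
choosing coordinates. -/
theorem cover_hom_ext {f g : Cover E →ₗ[Atilde] N}
    (h : ∀ e, f (toCover E e) = g (toCover E e)) : f = g := by
  classical
  refine LinearMap.pi_ext' fun i => LinearMap.ext_ring ?_
  have := h (basis E i)
  rwa [toCover_basis] at this

/-- The map `e ↦ a φ(e) - φ(a e)`. -/
def coboundary (φ : E →ₛₗ[Atilde.ofSeriesHom] N) : E →ₛₗ[Atilde.ofSeriesHom] N where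
  toFun e := Atilde.a • φ e - φ (ABAction.a e)
  map_add' e f := by simp only [map_add, smul_add]; abel
  map_smul' S e := by
    -- The term b²S' arising from aS in Ã cancels the one arising from a(Se) in E, which is why the
    -- difference is ℂ[[b]]-linear although neither term is.
    rw [leibniz S e, map_add, LinearMap.map_smulₛₗ, LinearMap.map_smulₛₗ, LinearMap.map_smulₛₗ,
      ← mul_smul, Atilde.a_mul_ofSeriesHom, add_smul, mul_smul, smul_sub]
    abel

theorem coboundary_apply (φ : E →ₛₗ[Atilde.ofSeriesHom] N) (e : E) :
    coboundary φ e = Atilde.a • φ e - φ (ABAction.a e) := rfl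

variable (E) in
/-- The matrix of `a` in the basis of `E`. -/
def aMat (i j : Module.Free.ChooseBasisIndex ℂ⟦X⟧ E) : ℂ⟦X⟧ :=
  (basis E).repr (ABAction.a (basis E i)) j

variable (E) in
/-- The differential `x ⊗ e ↦ x a ⊗ e - x ⊗ a e`. -/
def coverD : Cover E →ₗ[Atilde] Cover E := coverLift (coboundary (toCover E))

theorem coverD_toCover (e : E) :
    coverD E (toCover E e) = Atilde.a • toCover E e - toCover E (ABAction.a e) :=
  coverLift_toCover _ e

theorem matD_toCover_basis (i : Module.Free.ChooseBasisIndex ℂ⟦X⟧ E) :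
    matD (aMat E) (toCover E (basis E i)) = coverD E (toCover E (basis E i)) := by
  classical
  rw [coverD_toCover, toCover_basis]
  exact matD_single (aMat E) i

/-- The basis-free differential serves for functoriality and the matrix one for the division
statement; both are Ã-linear, so agreement on the basis suffices. -/
theorem coverD_eq : coverD E = matD (aMat E) := by
  have h : (coverD E).comp (toCover E) = (matD (aMat E)).comp (toCover E) :=
    (basis E).ext fun i => (matD_toCover_basis i).symm
  exact cover_hom_ext fun e => LinearMap.congr_fun h e

variable (E) in
/-- The identity of `E`, as a map to the `Ã`-module attached to `E`. -/
def idSemi : E →ₛₗ[Atilde.ofSeriesHom] (toAtilde E) where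
  toFun e := e
  map_add' _ _ := rfl
  map_smul' S e := (act_ofSeries S e).symm

variable (E) in
/-- The augmentation `x ⊗ e ↦ x e`. -/
def coverπ : Cover E →ₗ[Atilde] (toAtilde E) := coverLift (idSemi E)

theorem coverπ_toCover (e : E) : coverπ E (toCover E e) = idSemi E e :=
  coverLift_toCover _ e

theorem coverπ_coverD (x : Cover E) : coverπ E (coverD E x) = 0 := by
  have : (coverπ E).comp (coverD E) = 0 := cover_hom_ext fun e => by
    rw [LinearMap.comp_apply, coverD_toCover, map_sub, map_smul, coverπ_toCover, coverπ_toCover,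
      LinearMap.zero_apply, sub_eq_zero]
    exact act_a e
  exact LinearMap.congr_fun this x

theorem coverD_injective : Function.Injective (coverD E) := by
  rw [injective_iff_map_eq_zero]
  intro x hx
  refine (matD_add_injective (aMat E) x 0 ?_).1
  rw [← coverD_eq, hx, map_zero, add_zero]

theorem exists_coverD_add (x : Cover E) : ∃ y e, x = coverD E y + toCover E e := by
  obtain ⟨y, v, rfl⟩ := exists_matD_add (aMat E) x
  refine ⟨y, (basis E).equivFun.symm v, ?_⟩
  rw [toCover, LinearMap.comp_apply, LinearEquiv.coe_coe, LinearEquiv.apply_symm_apply, coverD_eq]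

/-- Writing x = D(y) + 1 ⊗ e, the augmentation of x is e; if it vanishes, x = D(y). -/
theorem exact_coverD_coverπ : Function.Exact (coverD E) (coverπ E) := by
  intro x
  refine ⟨fun hx => ?_, ?_⟩
  · obtain ⟨y, e, rfl⟩ := exists_coverD_add x
    rw [map_add, coverπ_coverD, zero_add, coverπ_toCover] at hx
    have he : e = 0 := hx
    exact ⟨y, by rw [he, map_zero, add_zero]⟩
  · rintro ⟨y, rfl⟩
    exact coverπ_coverD y

theorem coverπ_surjective : Function.Surjective (coverπ E) := fun e =>
  ⟨toCover E (show E from e), coverπ_toCover (E := E) e⟩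

/-- A `ℂ[[b]]`-linear form on `E`, as a map to `Ã`. -/
def formToAtilde (φ : E →ₗ[ℂ⟦X⟧] E0) : E →ₛₗ[Atilde.ofSeriesHom] Atilde where
  toFun e := Atilde.ofSeriesHom (e0Equiv (φ e))
  map_add' e f := by rw [map_add, map_add, map_add]
  map_smul' S e := by rw [map_smul, map_smul, smul_eq_mul, map_mul, smul_eq_mul]

theorem formToAtilde_apply {E : Type} [AddCommGroup E] [Module ℂ⟦X⟧ E] 
    (φ : E →ₗ[ℂ⟦X⟧] E0) (e : E) :
    formToAtilde φ e = Atilde.ofSeriesHom (e0Equiv (φ e)) := rfl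

theorem coboundary_basis (t : E →ₛₗ[Atilde.ofSeriesHom] Atilde)
    (i : Module.Free.ChooseBasisIndex ℂ⟦X⟧ E) : coboundary t (basis E i) =
      Atilde.a * t (basis E i) - ∑ j, Atilde.ofSeriesHom (aMat E i j) * t (basis E j) := by
  rw [coboundary_apply, semilinear_apply t (ABAction.a _)]
  rfl

/-- In a basis, the coboundary of t is at - Mt for the column t of its values, so left division
provides both t and the values of φ. -/
theorem exists_coboundary_add (c : E →ₛₗ[Atilde.ofSeriesHom] Atilde) :
    ∃ t φ, c = coboundary t + formToAtilde φ := by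
  classical
  obtain ⟨t, v, h⟩ := exists_leftMat_add (aMat E) fun i => c (basis E i)
  -- A column of elements of Ã extends to a ℂ[[b]]-linear map on E by passing through Ã ⊗ E.
  have ht : ∀ i, ((Fintype.linearCombination Atilde t).comp (toCover E)) (basis E i) = t i := by
    intro i
    rw [LinearMap.comp_apply, toCover_basis, Fintype.linearCombination_apply_single, one_smul]
  refine ⟨(Fintype.linearCombination Atilde t).comp (toCover E),
    e0Equiv.symm.toLinearMap.comp ((basis E).constr ℂ⟦X⟧ v), (basis E).ext fun i => ?_⟩
  rw [LinearMap.add_apply, coboundary_basis, formToAtilde_apply, h]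
  simp only [ht]
  rw [LinearMap.comp_apply, LinearEquiv.coe_coe, LinearEquiv.apply_symm_apply,
    Module.Basis.constr_basis]

theorem form_eq_zero_of_coboundary {t : E →ₛₗ[Atilde.ofSeriesHom] Atilde} {φ : E →ₗ[ℂ⟦X⟧] E0}
    (h : formToAtilde φ = coboundary t) : φ = 0 := by
  have := leftMat_add_injective (aMat E) (fun i => t (basis E i)) (fun i => -e0Equiv (φ (basis E i))) fun i => by
    rw [← coboundary_basis, ← h, formToAtilde_apply, map_neg, add_neg_cancel]
  refine (basis E).ext fun i => ?_
  exact e0Equiv.map_eq_zero_iff.1 (neg_eq_zero.1 (congrFun this i))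

end Cover

/-! ### The computation of `E^*` -/

section ExtComputation

open CategoryTheory CategoryTheory.Abelian

variable (E : Type) [AddCommGroup E] [Module ℂ⟦X⟧ E] [ABAction E] [IsABModule E]

/-- The resolution `0 → Ã ⊗ E → Ã ⊗ E → E → 0`. -/
abbrev coverComplex : ShortComplex (ModuleCat.{0} Atilde) :=
  ShortComplex.mk (X₁ := ModuleCat.of Atilde (Cover E)) (X₂ := ModuleCat.of Atilde (Cover E))
    (X₃ := toAtilde E) (ModuleCat.ofHom (coverD E)) 
    (ModuleCat.ofHom (Y := (toAtilde E : Type)) (coverπ E))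
    (ModuleCat.hom_ext (LinearMap.ext coverπ_coverD))

theorem coverComplex_shortExact : (coverComplex E).ShortExact :=
  ModuleCat.shortComplex_shortExact _ exact_coverD_coverπ coverD_injective coverπ_surjective

instance : Projective (coverComplex E).X₂ :=
  inferInstanceAs (Projective (ModuleCat.of Atilde (Cover E)))

variable {E}

theorem coverLift_add (s t : E →ₛₗ[Atilde.ofSeriesHom] Atilde) :
    coverLift (s + t) = coverLift s + coverLift t :=
  cover_hom_ext fun e => by simp only [LinearMap.add_apply, coverLift_toCover]

theorem coverLift_comp_toCover (f : Cover E →ₗ[Atilde] Atilde) :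
    coverLift (LinearMap.comp f (toCover E)) = f :=
  cover_hom_ext fun e => coverLift_toCover _ e

theorem coverLift_coboundary (s : E →ₛₗ[Atilde.ofSeriesHom] Atilde) :
    coverLift (coboundary s) = (coverLift s).comp (coverD E) :=
  cover_hom_ext fun e => by
    rw [LinearMap.comp_apply, coverD_toCover, map_sub, map_smul]
    simp only [coverLift_toCover, coboundary_apply]

/-- The morphism `Ã ⊗ E → Ã` attached to a `ℂ[[b]]`-linear map `E → Ã`. -/
def coverHom (t : E →ₛₗ[Atilde.ofSeriesHom] Atilde) :
    ModuleCat.of Atilde (Cover E) ⟶ ModuleCat.of Atilde Atilde :=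
  ModuleCat.ofHom (coverLift t)

/-- The class in `E^* = Ext¹_Ã(E, Ã)` of a `ℂ[[b]]`-linear map `E → Ã`. -/
def dualClass (t : E →ₛₗ[Atilde.ofSeriesHom] Atilde) : Dual E :=
  (coverComplex_shortExact E).extClass.comp (Ext.mk₀ (coverHom t)) (add_zero 1)

theorem dualClass_add (s t : E →ₛₗ[Atilde.ofSeriesHom] Atilde) :
    dualClass (s + t) = dualClass s + dualClass t := by
  unfold dualClass coverHom
  rw [coverLift_add, ModuleCat.ofHom_add, Ext.mk₀_add, Ext.comp_add]
  rfl

/-- Since Ã ⊗ E is projective, its `Ext¹` vanishes and the connecting map from Hom(Ã ⊗ E, Ã) to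
`Ext¹` of E is onto. -/
theorem dualClass_surjective : Function.Surjective (dualClass (E := E)) := by
  intro ξ
  obtain ⟨x, hx⟩ := Ext.contravariant_sequence_exact₃ (coverComplex_shortExact E) _ ξ
    (Ext.eq_zero_of_projective _) (add_zero 1)
  obtain ⟨f, rfl⟩ := (Ext.mk₀_bijective _ _).2 x
  refine ⟨LinearMap.comp f.hom (toCover E), Eq.trans ?_ hx⟩
  unfold dualClass coverHom
  rw [coverLift_comp_toCover, ModuleCat.ofHom_hom]

/-- A coboundary corresponds to a map Ã ⊗ E → Ã factoring through D, and the extension class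
composed with D is zero. -/
theorem dualClass_coboundary (s : E →ₛₗ[Atilde.ofSeriesHom] Atilde) :
    dualClass (coboundary s) = 0 := by
  unfold dualClass coverHom
  rw [coverLift_coboundary, ModuleCat.ofHom_comp, ← Ext.mk₀_comp_mk₀]
  exact ShortComplex.ShortExact.extClass_comp_assoc _ _

/-- By exactness of the long sequence, a map with zero class factors through D, and restricting the
factor to the elements 1 ⊗ e gives s. -/
theorem exists_coboundary_of_dualClass_eq_zero {t : E →ₛₗ[Atilde.ofSeriesHom] Atilde}
    (h : dualClass t = 0) : ∃ s, t = coboundary s := by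
  obtain ⟨x, hx⟩ := Ext.contravariant_sequence_exact₁ (coverComplex_shortExact E) _ _
    (add_zero 1) h
  obtain ⟨f, rfl⟩ := (Ext.mk₀_bijective _ _).2 x
  rw [Ext.mk₀_comp_mk₀] at hx
  have hf := (Ext.mk₀_bijective _ _).1 hx
  refine ⟨LinearMap.comp f.hom (toCover E), LinearMap.ext fun e => ?_⟩
  have := congrArg (fun g => g.hom (toCover E e)) hf
  change f.hom (coverD E (toCover E e)) = coverLift t (toCover E e) at this
  rw [coverLift_toCover, coverD_toCover] at this
  rw [← this, coboundary_apply]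
  exact (map_sub f.hom _ _).trans (congrArg (· - _) (map_smul f.hom _ _))

/-- Right multiplication by an element of `Ã` on the `ℂ[[b]]`-linear maps `E → Ã`. -/
def mulRight (t : E →ₛₗ[Atilde.ofSeriesHom] Atilde) (y : Atilde) :
    E →ₛₗ[Atilde.ofSeriesHom] Atilde :=
  LinearMap.comp (LinearMap.toSpanSingleton Atilde Atilde y) t

theorem mulRight_apply {E : Type} [AddCommGroup E] [Module ℂ⟦X⟧ E] 
    (t : E →ₛₗ[Atilde.ofSeriesHom] Atilde) (y : Atilde) (e : E) :
    mulRight t y e = t e * y := rfl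

theorem coverLift_mulRight (t : E →ₛₗ[Atilde.ofSeriesHom] Atilde) (y : Atilde) :
    coverLift (mulRight t y) = (LinearMap.toSpanSingleton Atilde Atilde y).comp (coverLift t) :=
  cover_hom_ext fun e => by
    rw [LinearMap.comp_apply, coverLift_toCover, coverLift_toCover, mulRight_apply]
    rfl

theorem smul_dualClass (x : Atilde) (t : E →ₛₗ[Atilde.ofSeriesHom] Atilde) :
    x • dualClass t = dualClass (mulRight t (Atilde.theta x)) := by
  have h : coverHom (mulRight t (Atilde.theta x)) =
      coverHom t ≫ rightMulHom (Atilde.theta x) :=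
    congrArg ModuleCat.ofHom (coverLift_mulRight t _)
  unfold dualClass
  rw [h, ← Ext.mk₀_comp_mk₀]
  exact Ext.comp_assoc _ _ _ (add_zero 1) (add_zero 0) (by simp)

/-! ### Functoriality of the resolution and of the class map. -/

variable {F : Type} [AddCommGroup F] [Module ℂ⟦X⟧ F] [ABAction F] [IsABModule F]

/-- The map `Ã ⊗ E → Ã ⊗ F` induced by `f : E → F`. -/
def coverMap (f : ABHom E F) : Cover E →ₗ[Atilde] Cover F :=
  coverLift ((toCover F).comp f.toLinearMap)

theorem coverMap_toCover (f : ABHom E F) (e : E) :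
    coverMap f (toCover E e) = toCover F (f e) := coverLift_toCover _ e

theorem coverMap_coverD (f : ABHom E F) :
    (coverD F).comp (coverMap f) = (coverMap f).comp (coverD E) :=
  cover_hom_ext fun e => by
    rw [LinearMap.comp_apply, LinearMap.comp_apply, coverD_toCover, map_sub, map_smul,
      coverMap_toCover, coverMap_toCover, coverD_toCover]
    exact congrArg (fun y => _ - toCover F y) (f.map_a e).symm

theorem coverπ_coverMap (f : ABHom E F) :
    (coverπ F).comp (coverMap f) = f.toAtilde.hom.comp (coverπ E) :=
  cover_hom_ext fun e => by
    rw [LinearMap.comp_apply, LinearMap.comp_apply, coverMap_toCover, coverπ_toCover,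
      coverπ_toCover]
    rfl

theorem coverLift_coverMap (f : ABHom E F) (t : F →ₛₗ[Atilde.ofSeriesHom] Atilde) :
    coverLift (t.comp f.toLinearMap) = (coverLift t).comp (coverMap f) :=
  cover_hom_ext fun e => by
    rw [LinearMap.comp_apply, coverLift_toCover, coverMap_toCover, coverLift_toCover]
    rfl

/-- The morphism of resolutions induced by `f : E → F`. -/
def coverComplexMap (f : ABHom E F) : coverComplex E ⟶ coverComplex F where
  τ₁ := ModuleCat.ofHom (coverMap f)
  τ₂ := ModuleCat.ofHom (coverMap f)
  τ₃ := f.toAtilde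
  comm₁₂ := congrArg ModuleCat.ofHom (coverMap_coverD f)
  comm₂₃ := ModuleCat.hom_ext (coverπ_coverMap f)

/-- f induces a morphism of resolutions, and naturality of the extension class moves composition
with f from E^* to the representing maps. -/
theorem map_dualClass (f : ABHom E F) (t : F →ₛₗ[Atilde.ofSeriesHom] Atilde) :
    Dual.map f (dualClass t) = dualClass (t.comp f.toLinearMap) := by
  have h : coverHom (t.comp f.toLinearMap) = (coverComplexMap f).τ₁ ≫ coverHom t :=
    congrArg ModuleCat.ofHom (coverLift_coverMap f t)
  have h2 := ShortComplex.ShortExact.extClass_naturality (coverComplex_shortExact E)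
    (coverComplex_shortExact F) (coverComplexMap f)
  change (Ext.mk₀ f.toAtilde).comp ((coverComplex_shortExact F).extClass.comp _ (add_zero 1))
    (zero_add 1) = _
  unfold dualClass
  rw [h, ← Ext.mk₀_comp_mk₀]
  refine (Ext.comp_assoc _ _ _ (zero_add 1) (add_zero 1) (by simp)).symm.trans ?_
  refine Eq.trans ?_ (Ext.comp_assoc _ _ _ (add_zero 1) (add_zero 0) (by simp))
  exact congrArg (fun x => Ext.comp x (Ext.mk₀ (coverHom t)) (add_zero 1)) h2.symm

theorem HomAB.smul_toLin {E : Type} [AddCommGroup E] [Module ℂ⟦X⟧ E] 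
    {F : Type} [AddCommGroup F] [Module ℂ⟦X⟧ F] (S : ℂ⟦X⟧) (φ : HomAB E F) (e : E) :
    (S • φ).toLin e = PowerSeries.evalNegHom S • φ.toLin e := rfl

theorem HomAB.a_toLin (φ : HomAB E F) (e : E) :
    (ABAction.a φ).toLin e = φ.toLin (ABAction.a e) - ABAction.a (φ.toLin e) := rfl

/-- Since φ(e)a = aφ(e) - b²φ(e)', right multiplication by a differs from the coboundary of φ by
φ(ae) - b²φ(e)'. This is the origin of the operator φ∘a - a∘φ, the second term being the action of a
on E_0. -/
theorem formToAtilde_a (φ : HomAB E E0) :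
    mulRight (formToAtilde φ.toLin) Atilde.a =
      coboundary (formToAtilde φ.toLin) + formToAtilde (ABAction.a φ).toLin := by
  refine LinearMap.ext fun e => ?_
  rw [LinearMap.add_apply, mulRight_apply, coboundary_apply]
  simp only [formToAtilde_apply, smul_eq_mul, Atilde.a_mul_ofSeriesHom, HomAB.a_toLin, map_sub,
    e0Equiv_a]
  abel

theorem formToAtilde_smul {E : Type} [AddCommGroup E] [Module ℂ⟦X⟧ E] (S : ℂ⟦X⟧) (φ : HomAB E E0) :
    formToAtilde (S • φ).toLin =
      mulRight (formToAtilde φ.toLin) (Atilde.theta (Atilde.ofSeriesHom S)) := by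
  refine LinearMap.ext fun e => ?_
  rw [mulRight_apply, formToAtilde_apply, formToAtilde_apply, HomAB.smul_toLin, map_smul,
    smul_eq_mul, Atilde.theta_ofSeriesHom, ← map_mul, mul_comm]

variable (E) in
/-- The map `Hom_{a,b}(E, E_0) → E^*`. -/
def homToDual : HomAB E E0 →ₗ[ℂ⟦X⟧] Dual E where
  toFun φ := dualClass (formToAtilde φ.toLin)
  map_add' φ ψ := by
    rw [← dualClass_add]
    exact congrArg dualClass (LinearMap.ext fun e => map_add Atilde.ofSeriesHom _ _)
  map_smul' S φ := by
    rw [formToAtilde_smul, RingHom.id_apply, Dual.series_smul, smul_dualClass]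

theorem homToDual_apply (φ : HomAB E E0) :
    homToDual E φ = dualClass (formToAtilde φ.toLin) := rfl

/-- Each class has exactly one representative with values in ℂ[[b]]: uniqueness of the mirrored
division gives injectivity, existence gives surjectivity. -/
theorem homToDual_bijective : Function.Bijective (homToDual E) := by
  constructor
  · rw [injective_iff_map_eq_zero]
    intro φ hφ
    obtain ⟨s, hs⟩ := exists_coboundary_of_dualClass_eq_zero hφ
    exact form_eq_zero_of_coboundary hs
  · intro ξ
    obtain ⟨c, rfl⟩ := dualClass_surjective ξ
    obtain ⟨t, φ, rfl⟩ := exists_coboundary_add c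
    refine ⟨HomAB.of φ, ?_⟩
    rw [dualClass_add, dualClass_coboundary, zero_add]
    rfl

theorem homToDual_a (φ : HomAB E E0) :
    homToDual E (ABAction.a φ) = ABAction.a (homToDual E φ) := by
  rw [Dual.a_apply, homToDual_apply, homToDual_apply, smul_dualClass, Atilde.theta_a,
    formToAtilde_a, dualClass_add, dualClass_coboundary, zero_add]

/-- The inverse of an isomorphism of (a,b)-modules. -/
def ABIso.symm {M N : Type} [AddCommGroup M] [Module ℂ⟦X⟧ M] [ABAction M]
    [AddCommGroup N] [Module ℂ⟦X⟧ N] [ABAction N] (f : ABIso M N) : ABIso N M where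
  toLinearEquiv := f.toLinearEquiv.symm
  map_a y := by
    obtain ⟨x, rfl⟩ := f.toLinearEquiv.surjective y
    refine f.toLinearEquiv.injective ?_
    have h := f.map_a x
    change f.toLinearEquiv (f.toLinearEquiv.symm (ABAction.a (f.toLinearEquiv x))) =
      f.toLinearEquiv (ABAction.a (f.toLinearEquiv.symm (f.toLinearEquiv x)))
    rw [LinearEquiv.apply_symm_apply, LinearEquiv.symm_apply_apply]
    exact h.symm

/-- The composition of isomorphisms of (a,b)-modules. -/
def ABIso.trans {M N P : Type} [AddCommGroup M] [Module ℂ⟦X⟧ M] [ABAction M]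
    [AddCommGroup N] [Module ℂ⟦X⟧ N] [ABAction N] [AddCommGroup P] [Module ℂ⟦X⟧ P] [ABAction P]
    (f : ABIso M N) (g : ABIso N P) : ABIso M P where
  toLinearEquiv := f.toLinearEquiv.trans g.toLinearEquiv
  map_a x := (congrArg g.toLinearEquiv (f.map_a x)).trans (g.map_a _)

variable (E) in
/-- The isomorphism `E^* ≅ Hom_{a,b}(E, E_0)`. -/
def dualIso : ABIso (Dual E) (HomAB E E0) :=
  ABIso.symm
    { toLinearEquiv := LinearEquiv.ofBijective (homToDual E) homToDual_bijective
      map_a := homToDual_a }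

theorem homToDual_dualIso (ξ : Dual E) : homToDual E (dualIso E ξ) = ξ :=
  (LinearEquiv.ofBijective (homToDual E) homToDual_bijective).apply_symm_apply ξ

/-- The map `Hom_{a,b}(F, E_0) → Hom_{a,b}(E, E_0)` induced by `f : E → F`. -/
def HomAB.precomp (f : ABHom E F) : HomAB F E0 →ₗ[ℂ⟦X⟧] HomAB E E0 where
  toFun φ := HomAB.of (φ.toLin.comp f.toLinearMap)
  map_add' _ _ := rfl
  map_smul' _ _ := rfl

theorem HomAB.precomp_apply {E : Type} [AddCommGroup E] [Module ℂ⟦X⟧ E] [ABAction E]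
    {F : Type} [AddCommGroup F] [Module ℂ⟦X⟧ F] [ABAction F] (f : ABHom E F) (φ : HomAB F E0) (e : E) :
    (HomAB.precomp f φ).toLin e = φ.toLin (f e) := rfl

/-- Restriction along f preserves values in ℂ[[b]], so it carries the distinguished representative
on F to the one on E. -/
theorem dualIso_map (f : ABHom E F) (ξ : Dual F) :
    dualIso E (Dual.map f ξ) = HomAB.precomp f (dualIso F ξ) := by
  refine homToDual_bijective.1 ?_
  rw [homToDual_dualIso, homToDual_apply]
  conv_lhs => rw [← homToDual_dualIso ξ, homToDual_apply, map_dualClass]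
  rfl

end ExtComputation

/-! ### `Hom_{a,b}(E, E_0)` as an (a,b)-module -/

/-! ### Isomorphisms of (a,b)-modules and transport of structure. -/

section Iso

variable {M N P : Type} [AddCommGroup M] [Module ℂ⟦X⟧ M] [ABAction M]
  [AddCommGroup N] [Module ℂ⟦X⟧ N] [ABAction N] [AddCommGroup P] [Module ℂ⟦X⟧ P] [ABAction P]

/-- The morphism underlying an isomorphism of (a,b)-modules. -/
def ABIso.toABHom (f : ABIso M N) : ABHom M N where
  toLinearMap := f.toLinearEquiv.toLinearMap
  map_a := f.map_a

/-- The composition of morphisms of (a,b)-modules. -/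
def ABHom.comp (g : ABHom N P) (f : ABHom M N) : ABHom M P where
  toLinearMap := g.toLinearMap.comp f.toLinearMap
  map_a x := (congrArg g.toLinearMap (f.map_a x)).trans (g.map_a _)

/-- A bijective morphism is an isomorphism. -/
def ABIso.ofBijective (f : ABHom M N) (h : Function.Bijective f) : ABIso M N where
  toLinearEquiv := LinearEquiv.ofBijective f.toLinearMap h
  map_a := f.map_a

theorem ABIso.isABModule (f : ABIso M N) [IsABModule N] : IsABModule M where
  free := Module.Free.of_equiv f.toLinearEquiv.symm
  finite := Module.Finite.equiv f.toLinearEquiv.symm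
  continuous_a := continuous_a

theorem ABIso.hasSimplePole (f : ABIso M N) (h : HasSimplePole N) : HasSimplePole M := fun x => by
  obtain ⟨y, hy⟩ := h (f x)
  refine ⟨f.toLinearEquiv.symm y, f.toLinearEquiv.injective ?_⟩
  rw [map_smul, LinearEquiv.apply_symm_apply]
  exact (f.map_a x).trans hy

theorem ABIso.map_flat_le (f : ABIso M N) : (flat M).map f.toLinearEquiv.toLinearMap ≤ flat N := by
  refine isGreatest_flat.2 ?_
  rintro _ ⟨x, hx, rfl⟩
  obtain ⟨y, hy, e⟩ := isSimplePoleSub_flat x hx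
  refine ⟨f y, ⟨y, hy, rfl⟩, ?_⟩
  exact (f.map_a x).symm.trans ((congrArg f.toLinearEquiv e).trans (map_smul f.toLinearEquiv _ _))

theorem ABIso.map_flat (f : ABIso M N) : (flat M).map f.toLinearEquiv.toLinearMap = flat N := by
  refine le_antisymm f.map_flat_le fun y hy => ?_
  exact ⟨f.symm y, f.symm.map_flat_le ⟨y, hy, rfl⟩, f.toLinearEquiv.apply_symm_apply y⟩

/-- An isomorphism `M ≅ N` induces an isomorphism `M^b ≅ N^b`. -/
def ABIso.flat (f : ABIso M N) : ABIso (Flat M) (Flat N) where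
  toLinearEquiv := f.toLinearEquiv.ofSubmodules _ _ f.map_flat
  map_a x := Subtype.ext (f.map_a (x : M))

end Iso

/-! ### Forms with values in E_0: finiteness and simple poles. -/

section Forms

theorem X_pow_smul_injective {E : Type} [AddCommGroup E] [Module ℂ⟦X⟧ E]
    [Module.IsTorsionFree ℂ⟦X⟧ E] (n : ℕ) {x y : E}
    (h : (PowerSeries.X ^ n : ℂ⟦X⟧) • x = (PowerSeries.X ^ n : ℂ⟦X⟧) • y) : x = y :=
  smul_right_injective E (pow_ne_zero n PowerSeries.X_ne_zero) h

theorem X_smul_injective {E : Type} [AddCommGroup E] [Module ℂ⟦X⟧ E]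
    [Module.IsTorsionFree ℂ⟦X⟧ E] {x y : E}
    (h : (PowerSeries.X : ℂ⟦X⟧) • x = (PowerSeries.X : ℂ⟦X⟧) • y) : x = y :=
  smul_right_injective E PowerSeries.X_ne_zero h

/-- Without torsion the quotient by b is unique, so pointwise quotients assemble into a linear map.
-/
theorem exists_X_smul_eq {E F : Type} [AddCommGroup E] [Module ℂ⟦X⟧ E] [AddCommGroup F]
    [Module ℂ⟦X⟧ F] [Module.IsTorsionFree ℂ⟦X⟧ F] (g : E →ₗ[ℂ⟦X⟧] F)
    (h : ∀ e, ∃ y, g e = (PowerSeries.X : ℂ⟦X⟧) • y) :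
    ∃ k : E →ₗ[ℂ⟦X⟧] F, g = (PowerSeries.X : ℂ⟦X⟧) • k := by
  choose k hk using h
  refine ⟨
    { toFun := k
      map_add' := fun e f => X_smul_injective (by rw [← hk, smul_add, ← hk, ← hk, map_add])
      map_smul' := fun S e => X_smul_injective (by
        rw [← hk, map_smul, hk, smul_comm, RingHom.id_apply]) }, LinearMap.ext hk⟩

theorem hasSimplePole_E0 : HasSimplePole E0 := fun x =>
  ⟨e0Equiv.symm (PowerSeries.X * PowerSeries.derivative ℂ (e0Equiv x)), e0Equiv.injective (by
    rw [e0Equiv_a, map_smul, LinearEquiv.apply_symm_apply, smul_eq_mul, pow_two, mul_assoc])⟩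

variable (E : Type) [AddCommGroup E] [Module ℂ⟦X⟧ E] [ABAction E] [IsABModule E]

/-- The coordinates of a form in the basis dual to a basis of `E`. -/
def homCoords : HomAB E E0 ≃ₗ[ℂ⟦X⟧] (Module.Free.ChooseBasisIndex ℂ⟦X⟧ E → ℂ⟦X⟧) where
  -- The substitution b ↦ -b makes the coordinates linear for the action of S as S(-b).
  toFun φ i := PowerSeries.evalNegHom (e0Equiv (φ.toLin (basis E i)))
  map_add' φ ψ := funext fun i =>
    (congrArg PowerSeries.evalNegHom (map_add e0Equiv _ _)).trans (map_add _ _ _)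
  map_smul' S φ := funext fun i => by
    rw [HomAB.smul_toLin, map_smul, smul_eq_mul, map_mul, evalNegHom_evalNegHom]
    rfl
  invFun v := HomAB.of (e0Equiv.symm.toLinearMap.comp
    ((basis E).constr ℂ⟦X⟧ fun i => PowerSeries.evalNegHom (v i)))
  left_inv φ := (basis E).ext fun i => e0Equiv.injective (by
    change (basis E).constr ℂ⟦X⟧ _ (basis E i) = _
    rw [Module.Basis.constr_basis, evalNegHom_evalNegHom]
    rfl)
  right_inv v := funext fun i => by
    change PowerSeries.evalNegHom ((basis E).constr ℂ⟦X⟧ _ (basis E i)) = _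
    rw [Module.Basis.constr_basis, evalNegHom_evalNegHom]

instance : IsABModule (HomAB E E0) where
  free := Module.Free.of_equiv (homCoords E).symm
  finite := Module.Finite.equiv (homCoords E).symm
  continuous_a := continuous_a

instance : IsABModule (Dual E) := (dualIso E).isABModule

variable {E}

theorem HomAB.ext {E : Type} [AddCommGroup E] [Module ℂ⟦X⟧ E] {φ ψ : HomAB E E0} (h : ∀ e, φ.toLin e = ψ.toLin e) : φ = ψ :=
  LinearMap.ext h

theorem HomAB.X_smul_toLin {E : Type} [AddCommGroup E] [Module ℂ⟦X⟧ E] 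
    (φ : HomAB E E0) (e : E) :
    ((PowerSeries.X : ℂ⟦X⟧) • φ).toLin e = -((PowerSeries.X : ℂ⟦X⟧) • φ.toLin e) := by
  rw [HomAB.smul_toLin, PowerSeries.evalNegHom_X, neg_smul]

theorem hasSimplePole_homAB (h : HasSimplePole E) : HasSimplePole (HomAB E E0) := by
  intro φ
  obtain ⟨k, hk⟩ := exists_X_smul_eq (ABAction.a φ).toLin fun e => by
    obtain ⟨y, hy⟩ := h e
    obtain ⟨z, hz⟩ := hasSimplePole_E0 (φ.toLin e)
    exact ⟨φ.toLin y - z, by rw [HomAB.a_toLin, hy, hz, map_smul, smul_sub]⟩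
  -- The sign compensates for b acting on forms as -b.
  refine ⟨HomAB.of (-k), HomAB.ext fun e => ?_⟩
  rw [hk, HomAB.X_smul_toLin]
  change (PowerSeries.X : ℂ⟦X⟧) • k e = -((PowerSeries.X : ℂ⟦X⟧) • -k e)
  rw [smul_neg, neg_neg]

variable {F : Type} [AddCommGroup F] [Module ℂ⟦X⟧ F] [ABAction F] [IsABModule F]

/-- The morphism `Hom_{a,b}(F, E_0) → Hom_{a,b}(E, E_0)` induced by `f : E → F`. -/
def HomAB.precompHom (f : ABHom E F) : ABHom (HomAB F E0) (HomAB E E0) where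
  toLinearMap := HomAB.precomp f
  map_a φ := HomAB.ext fun e => by
    change φ.toLin (ABAction.a (f e)) - _ = φ.toLin (f (ABAction.a e)) - _
    rw [show f (ABAction.a e) = ABAction.a (f e) from f.map_a e]
    rfl

/-- An isomorphism `E ≅ F` induces an isomorphism `Hom_{a,b}(F, E_0) ≅ Hom_{a,b}(E, E_0)`. -/
def ABIso.homAB (f : ABIso E F) : ABIso (HomAB F E0) (HomAB E E0) :=
  ABIso.ofBijective (HomAB.precompHom f.toABHom) (by
    refine ⟨fun φ ψ h => HomAB.ext fun y => ?_, fun φ => ?_⟩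
    · obtain ⟨x, rfl⟩ := f.toLinearEquiv.surjective y
      exact LinearMap.congr_fun h x
    · refine ⟨HomAB.of (φ.toLin.comp f.toLinearEquiv.symm.toLinearMap), HomAB.ext fun e => ?_⟩
      exact congrArg φ.toLin (f.toLinearEquiv.symm_apply_apply e))

/-! ### Biduality. -/

theorem evalNegHom_derivative (S : ℂ⟦X⟧) :
    PowerSeries.derivative ℂ (PowerSeries.evalNegHom S) =
      -PowerSeries.evalNegHom (PowerSeries.derivative ℂ S) := by
  ext n
  rw [PowerSeries.coeff_derivative, map_neg, PowerSeries.evalNegHom, PowerSeries.coeff_rescale,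
    PowerSeries.coeff_rescale, PowerSeries.coeff_derivative]
  ring

/-- The automorphism `S(b) ↦ S(-b)`, as a map on `E_0`. -/
def E0.neg (x : E0) : E0 := e0Equiv.symm (PowerSeries.evalNegHom (e0Equiv x))

theorem E0.neg_add (x y : E0) : E0.neg (x + y) = E0.neg x + E0.neg y := by
  simp only [E0.neg, map_add]

theorem E0.neg_smul (S : ℂ⟦X⟧) (x : E0) :
    E0.neg (S • x) = PowerSeries.evalNegHom S • E0.neg x := by
  simp only [E0.neg, map_smul, smul_eq_mul, map_mul]
  rw [← smul_eq_mul, map_smul]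

theorem E0.neg_neg (x : E0) : E0.neg (E0.neg x) = x := by
  simp only [E0.neg, LinearEquiv.apply_symm_apply, evalNegHom_evalNegHom,
    LinearEquiv.symm_apply_apply]

/-- The operator b² d/db changes sign under b ↦ -b. -/
theorem E0.a_neg (x : E0) : ABAction.a (E0.neg x) = -E0.neg (ABAction.a x) := by
  refine e0Equiv.injective ?_
  rw [e0Equiv_a, map_neg]
  simp only [E0.neg, LinearEquiv.apply_symm_apply, e0Equiv_a, evalNegHom_derivative, map_mul,
    map_pow, PowerSeries.evalNegHom_X]
  ring

theorem E0.neg_sub (x y : E0) : E0.neg (x - y) = E0.neg x - E0.neg y := by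
  simp only [E0.neg, map_sub]

variable (E) in
/-- The biduality morphism `e ↦ (φ ↦ φ(e)(-b))`. -/
def bidualHom : ABHom E (HomAB (HomAB E E0) E0) where
  toFun e := HomAB.of
    { toFun := fun φ => E0.neg (φ.toLin e)
      map_add' := fun φ ψ => E0.neg_add _ _
      map_smul' := fun S φ => by
        rw [HomAB.smul_toLin, E0.neg_smul, evalNegHom_evalNegHom, RingHom.id_apply] }
  map_add' e f := HomAB.ext fun φ => by
    change E0.neg (φ.toLin (e + f)) = E0.neg (φ.toLin e) + E0.neg (φ.toLin f)
    rw [map_add, E0.neg_add]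
  map_smul' S e := HomAB.ext fun φ => by
    change E0.neg (φ.toLin (S • e)) = PowerSeries.evalNegHom S • E0.neg (φ.toLin e)
    rw [map_smul, E0.neg_smul]
  map_a e := HomAB.ext fun φ => by
    change E0.neg (φ.toLin (ABAction.a e)) =
      E0.neg (φ.toLin (ABAction.a e) - ABAction.a (φ.toLin e)) - ABAction.a (E0.neg (φ.toLin e))
    -- The two terms involving aφ(e) cancel, thanks to the sign change of a under b ↦ -b.
    rw [E0.neg_sub, E0.a_neg]
    abel

theorem bidualHom_apply (e : E) (φ : HomAB E E0) :
    (bidualHom E e).toLin φ = E0.neg (φ.toLin e) := rfl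

/-- Once the substitutions b ↦ -b are undone, this is reflexivity of a free ℂ[[b]]-module of finite
type. -/
theorem bidualHom_bijective : Function.Bijective (bidualHom E) := by
  constructor
  · rw [injective_iff_map_eq_zero]
    intro e he
    refine (basis E).ext_elem fun i => ?_
    have h := LinearMap.congr_fun he (HomAB.of (e0Equiv.symm.toLinearMap.comp ((basis E).coord i)))
    have h2 : e0Equiv.symm ((basis E).repr e i) = 0 := by
      have := congrArg E0.neg h
      refine (E0.neg_neg _).symm.trans (this.trans ?_)
      change E0.neg 0 = 0
      simp [E0.neg]
    rw [map_zero]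
    exact e0Equiv.symm.map_eq_zero_iff.1 h2
  · intro Ξ
    -- Ξ is linear for the twisted actions; composing with b ↦ -b gives an honest functional on the
    -- ordinary dual.
    let Ψ : Module.Dual ℂ⟦X⟧ (Module.Dual ℂ⟦X⟧ E) :=
      { toFun := fun f =>
          e0Equiv (E0.neg (Ξ.toLin (HomAB.of (e0Equiv.symm.toLinearMap.comp f))))
        map_add' := fun f g => by
          rw [← map_add, ← E0.neg_add, ← map_add]
          congr 3
        map_smul' := fun S f => by
          rw [RingHom.id_apply, ← map_smul, ← evalNegHom_evalNegHom S, ← E0.neg_smul, ← map_smul,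
            evalNegHom_evalNegHom]
          congr 3
          refine HomAB.ext fun e => ?_
          rw [HomAB.smul_toLin, evalNegHom_evalNegHom]
          exact map_smul e0Equiv.symm _ _ }
    obtain ⟨e, he⟩ := (Module.evalEquiv ℂ⟦X⟧ E).surjective Ψ
    refine ⟨e, HomAB.ext fun φ => ?_⟩
    have h : e0Equiv (φ.toLin e) = e0Equiv (E0.neg (Ξ.toLin φ)) :=
      LinearMap.congr_fun he (e0Equiv.toLinearMap.comp φ.toLin)
    rw [bidualHom_apply, e0Equiv.injective h, E0.neg_neg]

variable (E) in
/-- Biduality. -/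
def bidualIso : ABIso E (HomAB (HomAB E E0) E0) := ABIso.ofBijective (bidualHom E) bidualHom_bijective

end Forms

/-! ### `E[b⁻¹]` and the saturation -/

section Localization

section Basic

variable {M : Type} [AddCommGroup M] [Module ℂ⟦X⟧ M]

variable (M) in
/-- The map `M → M[b⁻¹]`. -/
abbrev toLoc : M →ₗ[ℂ⟦X⟧] Loc M :=
  LocalizedModule.mkLinearMap (Submonoid.powers (PowerSeries.X : ℂ⟦X⟧)) M

theorem exists_X_pow_smul_eq_toLoc (x : Loc M) :
    ∃ (n : ℕ) (e : M), (PowerSeries.X ^ n : ℂ⟦X⟧) • x = toLoc M e := by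
  obtain ⟨⟨e, ⟨_, n, rfl⟩⟩, h⟩ :=
    IsLocalizedModule.surj (Submonoid.powers (PowerSeries.X : ℂ⟦X⟧)) (toLoc M) x
  exact ⟨n, e, h⟩

theorem loc_X_pow_smul_injective (n : ℕ) {x y : Loc M}
    (h : (PowerSeries.X ^ n : ℂ⟦X⟧) • x = (PowerSeries.X ^ n : ℂ⟦X⟧) • y) : x = y :=
  IsLocalizedModule.smul_injective (toLoc M)
    (⟨PowerSeries.X ^ n, n, rfl⟩ : Submonoid.powers (PowerSeries.X : ℂ⟦X⟧)) h

theorem loc_X_smul_injective {x y : Loc M}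
    (h : (PowerSeries.X : ℂ⟦X⟧) • x = (PowerSeries.X : ℂ⟦X⟧) • y) : x = y :=
  loc_X_pow_smul_injective 1 (by rwa [pow_one])

theorem bInv_X_smul (x : Loc M) : bInv ((PowerSeries.X : ℂ⟦X⟧) • x) = x :=
  loc_X_smul_injective (X_smul_bInv _)

theorem toLoc_injective [Module.IsTorsionFree ℂ⟦X⟧ M] : Function.Injective (toLoc M) := by
  rw [injective_iff_map_eq_zero]
  intro x hx
  obtain ⟨⟨_, n, rfl⟩, h⟩ :=
    (IsLocalizedModule.eq_zero_iff (Submonoid.powers (PowerSeries.X : ℂ⟦X⟧)) (toLoc M)).1 hx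
  exact X_pow_smul_injective n (h.trans (smul_zero _).symm)

theorem a_toLoc [ABAction M] (e : M) : ABAction.a (toLoc M e) = toLoc M (ABAction.a e) := by
  change locA (LocalizedModule.mk e 1) = LocalizedModule.mk (ABAction.a e) 1
  rw [locA_mk, mul_one, OneMemClass.coe_one, ← map_one PowerSeries.C, PowerSeries.derivative_C,
    mul_zero, zero_smul, sub_zero, map_one, one_smul]

variable {N : Type} [AddCommGroup N] [Module ℂ⟦X⟧ N]

/-- The map `M[b⁻¹] → N[b⁻¹]` induced by `φ : M → N`. -/
def locMap (φ : M →ₗ[ℂ⟦X⟧] N) : Loc M →ₗ[ℂ⟦X⟧] Loc N :=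
  IsLocalizedModule.map (Submonoid.powers (PowerSeries.X : ℂ⟦X⟧)) (toLoc M) (toLoc N) φ

theorem locMap_toLoc (φ : M →ₗ[ℂ⟦X⟧] N) (e : M) : locMap φ (toLoc M e) = toLoc N (φ e) :=
  IsLocalizedModule.map_apply _ _ _ _ _

theorem locMap_injective {φ : M →ₗ[ℂ⟦X⟧] N} (h : Function.Injective φ) :
    Function.Injective (locMap φ) :=
  IsLocalizedModule.map_injective _ _ _ _ h

theorem locMap_bInv (φ : M →ₗ[ℂ⟦X⟧] N) (x : Loc M) : locMap φ (bInv x) = bInv (locMap φ x) :=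
  loc_X_smul_injective (by rw [← map_smul, X_smul_bInv, X_smul_bInv])

theorem locMap_X_smul (φ : M →ₗ[ℂ⟦X⟧] N) (x : Loc M) :
    locMap ((PowerSeries.X : ℂ⟦X⟧) • φ) x = (PowerSeries.X : ℂ⟦X⟧) • locMap φ x := by
  rw [locMap, map_smul]
  rfl

theorem locMap_neg (φ : M →ₗ[ℂ⟦X⟧] N) (x : Loc M) : locMap (-φ) x = -locMap φ x := by
  rw [locMap, map_neg]
  rfl

variable [ABAction M] [IsABModule M] [ABAction N] [IsABModule N]

/-- After multiplication by a power b^n clearing the denominator of x, the identity holds in M. The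
correction terms n b^(n+1) from moving a past b^n cancel, and b^n is injective on N[b⁻¹]. -/
theorem locMap_lam (φ : M →ₗ[ℂ⟦X⟧] N) (x : Loc M) :
    locMap (HomAB.lam φ) x = locMap φ (ABAction.a x) - ABAction.a (locMap φ x) := by
  obtain ⟨n, e, h⟩ := exists_X_pow_smul_eq_toLoc x
  have h1 : (PowerSeries.X ^ n : ℂ⟦X⟧) • ABAction.a x =
      toLoc M (ABAction.a e) - ((n : ℂ⟦X⟧) * PowerSeries.X ^ (n + 1)) • x := by
    rw [← a_toLoc, ← h, a_X_pow_smul, add_sub_cancel_right]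
  have h2 : (PowerSeries.X ^ n : ℂ⟦X⟧) • locMap φ x = toLoc N (φ e) := by
    rw [← map_smul, h, locMap_toLoc]
  have h3 : (PowerSeries.X ^ n : ℂ⟦X⟧) • ABAction.a (locMap φ x) =
      toLoc N (ABAction.a (φ e)) - ((n : ℂ⟦X⟧) * PowerSeries.X ^ (n + 1)) • locMap φ x := by
    rw [← a_toLoc, ← h2, a_X_pow_smul, add_sub_cancel_right]
  refine loc_X_pow_smul_injective n ?_
  rw [← map_smul, h, locMap_toLoc, smul_sub, ← map_smul, h1, h3, map_sub, map_smul, locMap_toLoc]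
  change toLoc N (φ (ABAction.a e) - ABAction.a (φ e)) = _
  rw [map_sub]
  abel

theorem locMap_a (f : ABHom M N) (x : Loc M) :
    locMap f.toLinearMap (ABAction.a x) = ABAction.a (locMap f.toLinearMap x) := by
  have h : HomAB.lam f.toLinearMap = 0 := LinearMap.ext fun e => sub_eq_zero.2 (f.map_a e)
  have := locMap_lam f.toLinearMap x
  rw [h, locMap, map_zero, LinearMap.zero_apply] at this
  exact (sub_eq_zero.1 this.symm)

end Basic

/-! ### Saturation and regularity. -/

section Saturation

variable {M N : Type} [AddCommGroup M] [Module ℂ⟦X⟧ M] [ABAction M]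
  [AddCommGroup N] [Module ℂ⟦X⟧ N] [ABAction N] [IsABModule N]

theorem sharp_le {L : Submodule ℂ⟦X⟧ (Loc M)} (h : LinearMap.range (toLoc M) ≤ L)
    (h' : ∀ x ∈ L, bInv (ABAction.a x) ∈ L) : sharp M ≤ L := sInf_le ⟨h, h'⟩

theorem hasSimplePole_sharp : HasSimplePole (Sharp M) := fun x =>
  ⟨⟨bInv (ABAction.a (x : Loc M)), bInv_a_mem_sharp _ x.2⟩, Subtype.ext (X_smul_bInv _).symm⟩

theorem hasSimplePole_flat : HasSimplePole (Flat M) := fun x => by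
  obtain ⟨y, hy, h⟩ := isSimplePoleSub_flat (x : M) x.2
  exact ⟨⟨y, hy⟩, Subtype.ext h⟩

variable (M) in
/-- The inclusion of `M` in its saturation. -/
def toSharp : ABHom M (Sharp M) where
  toLinearMap := (toLoc M).codRestrict (sharp M) fun e => range_le_sharp ⟨e, rfl⟩
  map_a e := Subtype.ext (a_toLoc e).symm

variable (M) in
/-- The inclusion of `M^b` in `M`. -/
def flatIncl : ABHom (Flat M) M where
  toLinearMap := (flat M).subtype
  map_a _ := rfl

theorem exists_X_pow_smul_eq_toSharp (x : Sharp M) :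
    ∃ (n : ℕ) (e : M), (PowerSeries.X ^ n : ℂ⟦X⟧) • x = toSharp M e := by
  obtain ⟨n, e, h⟩ := exists_X_pow_smul_eq_toLoc (x : Loc M)
  exact ⟨n, e, Subtype.ext h⟩

theorem bInv_a_toLoc_mem {N : Type} [AddCommGroup N] [Module ℂ⟦X⟧ N] [ABAction N]
    (hN : HasSimplePole N) (y : N) :
    bInv (ABAction.a (toLoc N y)) ∈ LinearMap.range (toLoc N) := by
  obtain ⟨z, hz⟩ := hN y
  exact ⟨z, by rw [a_toLoc, hz, map_smul, bInv_X_smul]⟩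

/-- A sub-(a,b)-module of a simple pole (a,b)-module is regular. -/
theorem isRegularAB_of_injective [IsABModule M] (f : ABHom M N) (hf : Function.Injective f)
    (hN : HasSimplePole N) : IsRegularAB M := by
  -- N has a simple pole, so its image in N[b⁻¹] is stable under b⁻¹a; its preimage in M[b⁻¹] is
  -- then one of the submodules whose intersection is M^♯.
  have h : sharp M ≤ (LinearMap.range (toLoc N)).comap (locMap f.toLinearMap) := by
    refine sharp_le ?_ ?_
    · rintro _ ⟨e, rfl⟩
      exact ⟨f e, (locMap_toLoc _ _).symm⟩
    · rintro x ⟨y, hy⟩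
      rw [Submodule.mem_comap, locMap_bInv, locMap_a, ← hy]
      exact bInv_a_toLoc_mem hN y
  -- M^♯ thus embeds in a module of finite type over the Noetherian ring ℂ[[b]].
  have hfin : IsNoetherian ℂ⟦X⟧ (LinearMap.range (toLoc N)) := inferInstance
  refine ⟨Module.Finite.iff_fg.1 (Module.Finite.of_injective
    ((locMap f.toLinearMap).restrict (p := sharp M) (q := LinearMap.range (toLoc N)) h) ?_)⟩
  intro x y hxy
  exact Subtype.ext (locMap_injective hf (congrArg Subtype.val hxy))

end Saturation

/-! ### Duality exchanges E^♯ and E^b. -/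

section Duality

variable {E : Type} [AddCommGroup E] [Module ℂ⟦X⟧ E] [ABAction E] [IsABModule E]

/-- A finite set of generators of E^♯ has a common denominator. -/
theorem exists_X_pow_smul_sharp {E : Type} [AddCommGroup E] [Module ℂ⟦X⟧ E] [ABAction E]
    [IsRegularAB E] : ∃ n : ℕ, ∀ x ∈ sharp E,
    (PowerSeries.X ^ n : ℂ⟦X⟧) • x ∈ LinearMap.range (toLoc E) := by
  obtain ⟨s, hs⟩ := IsRegularAB.fg (E := E)
  choose k e he using fun x : Loc E => exists_X_pow_smul_eq_toLoc x
  refine ⟨s.sup k, fun x hx => ?_⟩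
  rw [← hs] at hx
  induction hx using Submodule.span_induction with
  | mem x hx =>
    rw [← Nat.sub_add_cancel (Finset.le_sup (f := k) hx), pow_add, mul_smul, he]
    exact Submodule.smul_mem _ _ ⟨e x, rfl⟩
  | zero => rw [smul_zero]; exact zero_mem _
  | add x y _ _ hx hy => rw [smul_add]; exact add_mem hx hy
  | smul c x _ hx => rw [smul_comm]; exact Submodule.smul_mem _ _ hx

/-- If b^n E^♯ lies in E, then it is a simple pole submodule of E containing b^n E, because a b^n x
= b · b^n (b⁻¹a x + n x). -/
theorem exists_X_pow_smul_mem_flat [IsRegularAB E] :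
    ∃ n : ℕ, ∀ e : E, (PowerSeries.X ^ n : ℂ⟦X⟧) • e ∈ flat E := by
  obtain ⟨n, hn⟩ := exists_X_pow_smul_sharp (E := E)
  let L : Submodule ℂ⟦X⟧ E :=
    ((sharp E).map (LinearMap.lsmul ℂ⟦X⟧ (Loc E) (PowerSeries.X ^ n))).comap (toLoc E)
  have hL : IsSimplePoleSub L := by
    rintro e ⟨x, hx, h⟩
    have hy : bInv (ABAction.a x) + ((n : ℂ⟦X⟧)) • x ∈ sharp E :=
      add_mem (bInv_a_mem_sharp x hx) (Submodule.smul_mem _ _ hx)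
    obtain ⟨f, hf⟩ := hn _ hy
    refine ⟨f, ⟨_, hy, hf.symm⟩, toLoc_injective ?_⟩
    have h' : (PowerSeries.X ^ n : ℂ⟦X⟧) • x = toLoc E e := h
    rw [map_smul, hf, ← a_toLoc, ← h', a_X_pow_smul, smul_comm PowerSeries.X, smul_add,
      X_smul_bInv, smul_add, ← mul_smul PowerSeries.X, ← mul_smul (PowerSeries.X ^ n)]
    congr 2
    ring
  refine ⟨n, fun e => isGreatest_flat.2 hL ⟨toLoc E e, range_le_sharp ⟨e, rfl⟩, ?_⟩⟩
  exact (map_smul (toLoc E) _ _).symm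

/-- E^b contains b^n E, and a form vanishing on b^n E vanishes because E_0 has no torsion. -/
theorem precompHom_flatIncl_injective [IsRegularAB E] :
    Function.Injective (HomAB.precompHom (flatIncl E)) := by
  obtain ⟨n, hn⟩ := exists_X_pow_smul_mem_flat (E := E)
  intro φ ψ h
  refine HomAB.ext fun e => X_pow_smul_injective n ?_
  rw [← map_smul, ← map_smul]
  exact LinearMap.congr_fun h ⟨_, hn e⟩

/-- E^* embeds by restriction in (E^b)^*, which has a simple pole because E^b has one. -/
instance [IsRegularAB E] : IsRegularAB (Dual E) :=
  isRegularAB_of_injective ((HomAB.precompHom (flatIncl E)).comp (dualIso E).toABHom)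
    (precompHom_flatIncl_injective.comp (dualIso E).toLinearEquiv.injective)
    (hasSimplePole_homAB hasSimplePole_flat)

theorem precompHom_toSharp_injective [IsRegularAB E] :
    Function.Injective (HomAB.precompHom (toSharp E)) := by
  intro φ ψ h
  refine HomAB.ext fun x => ?_
  obtain ⟨n, e, he⟩ := exists_X_pow_smul_eq_toSharp x
  refine X_pow_smul_injective n ?_
  rw [← map_smul, ← map_smul, he]
  exact LinearMap.congr_fun h e

/-- The forms that come from E^♯ are the image of a simple pole module under a morphism, hence a
simple pole submodule. -/
theorem precompHom_toSharp_mem_flat [IsRegularAB E] (φ : HomAB (Sharp E) E0) :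
    HomAB.precompHom (toSharp E) φ ∈ flat (HomAB E E0) := by
  have h : IsSimplePoleSub (LinearMap.range (HomAB.precompHom (toSharp E)).toLinearMap) := by
    rintro _ ⟨φ, rfl⟩
    obtain ⟨ψ, hψ⟩ := hasSimplePole_homAB hasSimplePole_sharp φ
    refine ⟨_, ⟨ψ, rfl⟩, ?_⟩
    rw [← map_smul, ← hψ]
    exact ((HomAB.precompHom (toSharp E)).map_a φ).symm
  exact isGreatest_flat.2 h ⟨φ, rfl⟩

/-- For φ in the biggest simple pole submodule, aφ = bψ with ψ in it too. Evaluating φ at b⁻¹a x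
then gives -ψ(x) + b⁻¹a(φ(x)), which lies in E_0 whenever φ(x) and ψ(x) do. All such φ must be
treated together, since ψ differs from φ. -/
theorem locMap_mem_of_mem_flat {x : Loc E} (hx : x ∈ sharp E) :
    ∀ φ ∈ flat (HomAB E E0), locMap φ.toLin x ∈ LinearMap.range (toLoc E0) := by
  let L : Submodule ℂ⟦X⟧ (Loc E) :=
    ⨅ φ : flat (HomAB E E0), (LinearMap.range (toLoc E0)).comap (locMap (φ : HomAB E E0).toLin)
  have hL : ∀ y, y ∈ L ↔
      ∀ φ ∈ flat (HomAB E E0), locMap φ.toLin y ∈ LinearMap.range (toLoc E0) := fun y => by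
    simp only [L, Submodule.mem_iInf, Submodule.mem_comap, Subtype.forall]
  rw [← hL]
  refine sharp_le ?_ ?_ hx
  · rintro _ ⟨e, rfl⟩
    exact (hL _).2 fun φ _ => ⟨φ.toLin e, (locMap_toLoc _ _).symm⟩
  · intro y hy
    rw [hL] at hy ⊢
    intro φ hφ
    obtain ⟨ψ, hψ, h⟩ := isSimplePoleSub_flat φ hφ
    -- As a plain linear map, bψ in the twisted structure is the negative of b times ψ.
    have h1 : HomAB.lam φ.toLin = -((PowerSeries.X : ℂ⟦X⟧) • ψ.toLin) :=
      LinearMap.ext fun e => (LinearMap.congr_fun h e).trans (HomAB.X_smul_toLin ψ e)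
    have h2 := locMap_lam φ.toLin y
    rw [h1, locMap_neg, locMap_X_smul, eq_sub_iff_add_eq] at h2
    obtain ⟨r, hr⟩ := hy φ hφ
    rw [locMap_bInv, ← h2, map_add, map_neg, bInv_X_smul, ← hr]
    exact add_mem (neg_mem (hy ψ hψ)) (bInv_a_toLoc_mem hasSimplePole_E0 r)

/-- The extension of φ to E[b⁻¹] maps E^♯ into the image of E_0, which is a copy of E_0 because E_0
has no torsion. -/
theorem exists_precompHom_toSharp_eq {φ : HomAB E E0} (hφ : φ ∈ flat (HomAB E E0)) :
    ∃ ψ : Sharp E →ₗ[ℂ⟦X⟧] E0, ∀ e, ψ (toSharp E e) = φ.toLin e := by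
  let ρ := (locMap φ.toLin).restrict (p := sharp E) (q := LinearMap.range (toLoc E0))
    fun x hx => locMap_mem_of_mem_flat hx φ hφ
  let ε := LinearEquiv.ofInjective (toLoc E0) toLoc_injective
  refine ⟨ε.symm.toLinearMap.comp ρ, fun e => ε.injective ?_⟩
  refine (ε.apply_symm_apply _).trans (Subtype.ext ?_)
  exact locMap_toLoc _ _

variable (E) in
/-- `(E^♯)^* ≅ (E^*)^b`, in terms of `Hom_{a,b}(-, E_0)`. -/
def sharpFlatIso [IsRegularAB E] : ABIso (HomAB (Sharp E) E0) (Flat (HomAB E E0)) :=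
  ABIso.ofBijective
    { toLinearMap := (HomAB.precompHom (toSharp E)).toLinearMap.codRestrict _
        precompHom_toSharp_mem_flat
      map_a := fun φ => Subtype.ext ((HomAB.precompHom (toSharp E)).map_a φ) }
    ⟨fun _ _ h => precompHom_toSharp_injective (congrArg Subtype.val h), fun φ => by
      obtain ⟨ψ, hψ⟩ := exists_precompHom_toSharp_eq φ.2
      exact ⟨HomAB.of ψ, Subtype.ext (HomAB.ext hψ)⟩⟩

variable (E) in
/-- `(E^♯)^* ≅ (E^*)^b`. -/
def dualSharpIso [IsRegularAB E] : ABIso (Dual (Sharp E)) (Flat (Dual E)) :=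
  (dualIso (Sharp E)).trans ((sharpFlatIso E).trans (dualIso E).symm.flat)

variable (E) in
/-- `(E^b)^* ≅ (E^*)^♯`. -/
def dualFlatIso [IsRegularAB E] : ABIso (Dual (Flat E)) (Sharp (Dual E)) :=
  -- The first isomorphism for E^* identifies the dual of (E^*)^♯ with the simple pole part of the
  -- bidual, that is with E^b. Dualising once more and applying biduality to (E^*)^♯ concludes.
  have h : ABIso (HomAB (Sharp (Dual E)) E0) (Flat E) :=
    (sharpFlatIso (Dual E)).trans
      (((bidualIso E).trans (dualIso E).homAB).symm.flat)
  (dualIso (Flat E)).trans (h.homAB.trans (bidualIso (Sharp (Dual E))).symm)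

end Duality

end Localization

end

/-! ### Exactness of the duality -/

section Exactness

variable {E' E E'' : Type} [AddCommGroup E'] [Module ℂ⟦X⟧ E'] [ABAction E'] [IsABModule E']
  [AddCommGroup E] [Module ℂ⟦X⟧ E] [ABAction E] [IsABModule E]
  [AddCommGroup E''] [Module ℂ⟦X⟧ E''] [ABAction E''] [IsABModule E'']

/-- Exactness concerns only the underlying groups, and this identity turns f^* into composition of
forms with f. -/
theorem dualMap_apply_toLin (f : ABHom E' E) (ξ : Dual E) (e : E') :
    (dualIso E' (Dual.map f ξ)).toLin e = (dualIso E ξ).toLin (f e) := by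
  rw [dualIso_map, HomAB.precomp_apply]

theorem dual_ext {ξ η : Dual E} (h : ∀ e, (dualIso E ξ).toLin e = (dualIso E η).toLin e) :
    ξ = η :=
  (dualIso E).toLinearEquiv.injective (HomAB.ext h)

theorem exists_dualIso_toLin_eq (φ : E →ₗ[ℂ⟦X⟧] E0) : ∃ ξ : Dual E, (dualIso E ξ).toLin = φ :=
  (dualIso E).toLinearEquiv.surjective (HomAB.of φ)

theorem dualIso_zero_toLin (e : E) : (dualIso E 0).toLin e = 0 :=
  LinearMap.congr_fun (map_zero (dualIso E).toLinearEquiv) e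

theorem dualMap_injective (v : ABHom E E'') (hv : Function.Surjective v) :
    Function.Injective (Dual.map v) := by
  intro ξ η h
  refine dual_ext fun y => ?_
  obtain ⟨x, rfl⟩ := hv y
  rw [← dualMap_apply_toLin, ← dualMap_apply_toLin, h]

/-- E'' is free, so v has a ℂ[[b]]-linear section s, in general not commuting with a. A form
vanishing on u(E') is its composite with s∘v, because s(v(e)) - e lies in u(E'). -/
theorem dualMap_exact (u : ABHom E' E) (v : ABHom E E'') (huv : Function.Exact u v)
    (hv : Function.Surjective v) : Function.Exact (Dual.map v) (Dual.map u) := by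
  intro ξ
  constructor
  · intro h
    obtain ⟨s, hs⟩ := Module.projective_lifting_property v.toLinearMap LinearMap.id hv
    obtain ⟨η, hη⟩ := exists_dualIso_toLin_eq ((dualIso E ξ).toLin.comp s)
    refine ⟨η, dual_ext fun e => ?_⟩
    rw [dualMap_apply_toLin, hη, LinearMap.comp_apply, ← sub_eq_zero, ← map_sub]
    obtain ⟨e', he'⟩ := (huv (s (v e) - e)).1 (by
      rw [map_sub]
      exact sub_eq_zero.2 (LinearMap.congr_fun hs (v e)))
    rw [← he', ← dualMap_apply_toLin, h, dualIso_zero_toLin]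
  · rintro ⟨η, rfl⟩
    refine dual_ext fun e => ?_
    rw [dualMap_apply_toLin, dualMap_apply_toLin, dualIso_zero_toLin,
      show v (u e) = 0 from (huv (u e)).2 ⟨e, rfl⟩, map_zero]

/-- A ℂ[[b]]-linear section of v yields a ℂ[[b]]-linear retraction r of u, and a form on E' extends
to E by composition with r. -/
theorem dualMap_surjective (u : ABHom E' E) (v : ABHom E E'') (hu : Function.Injective u)
    (huv : Function.Exact u v) (hv : Function.Surjective v) :
    Function.Surjective (Dual.map u) := by
  obtain ⟨s, hs⟩ := Module.projective_lifting_property v.toLinearMap LinearMap.id hv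
  have h : (Function.Injective u.toLinearMap ∧ ∃ l, v.toLinearMap ∘ₗ l = LinearMap.id) ↔
      (Function.Surjective v.toLinearMap ∧ ∃ l, l ∘ₗ u.toLinearMap = LinearMap.id) :=
    huv.split_tfae'.out 0 1
  obtain ⟨_, r, hr⟩ := h.1 ⟨hu, s, hs⟩
  intro ξ
  obtain ⟨η, hη⟩ := exists_dualIso_toLin_eq ((dualIso E' ξ).toLin.comp r)
  refine ⟨η, dual_ext fun e => ?_⟩
  rw [dualMap_apply_toLin, hη, LinearMap.comp_apply]
  exact congrArg (dualIso E' ξ).toLin (LinearMap.congr_fun hr e)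

end Exactness

end ABModule

/-- For every (a,b)-module `E`, the dual `E^* = Ext¹_Ã(E, Ã)` is an (a,b)-module, functorially
isomorphic to `Hom_{a,b}(E, E_0)`; duality is exact, preserves simple poles and regularity, and
for regular `E` it exchanges the saturation `E^♯` and the biggest simple pole submodule `E^b`. -/
theorem mainTheorem4 :
    -- `E^*` is an (a,b)-module
    (∀ (E : Type) [AddCommGroup E] [Module ℂ⟦X⟧ E] [ABAction E] [IsABModule E],
      IsABModule (Dual E)) ∧
    -- there is a functorial isomorphism of (a,b)-modules `E^* ≅ Hom_{a,b}(E, E_0)`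
    (∃ Φ : ∀ (E : Type) [AddCommGroup E] [Module ℂ⟦X⟧ E] [ABAction E] [IsABModule E],
        ABIso (Dual E) (HomAB E E0),
      ∀ (E F : Type) [AddCommGroup E] [Module ℂ⟦X⟧ E] [ABAction E] [IsABModule E]
        [AddCommGroup F] [Module ℂ⟦X⟧ F] [ABAction F] [IsABModule F]
        (f : ABHom E F) (ξ : Dual F) (e : E),
        (Φ E (Dual.map f ξ)).toLin e = (Φ F ξ).toLin (f e)) ∧
    -- duality transforms short exact sequences into short exact sequences
    (∀ (E' E E'' : Type) [AddCommGroup E'] [Module ℂ⟦X⟧ E'] [ABAction E'] [IsABModule E']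
        [AddCommGroup E] [Module ℂ⟦X⟧ E] [ABAction E] [IsABModule E]
        [AddCommGroup E''] [Module ℂ⟦X⟧ E''] [ABAction E''] [IsABModule E'']
        (u : ABHom E' E) (v : ABHom E E''),
        Function.Injective u → Function.Exact u v → Function.Surjective v →
          Function.Injective (Dual.map v) ∧ Function.Exact (Dual.map v) (Dual.map u) ∧
            Function.Surjective (Dual.map u)) ∧
    -- the dual of a simple pole (a,b)-module has a simple pole
    (∀ (E : Type) [AddCommGroup E] [Module ℂ⟦X⟧ E] [ABAction E] [IsABModule E],
      HasSimplePole E → HasSimplePole (Dual E)) ∧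
    -- the dual of a regular (a,b)-module is regular, `(E^♯)^* ≅ (E^*)^b`, `(E^b)^* ≅ (E^*)^♯`
    (∀ (E : Type) [AddCommGroup E] [Module ℂ⟦X⟧ E] [ABAction E] [IsABModule E] [IsRegularAB E],
      IsRegularAB (Dual E) ∧
      Nonempty (ABIso (Dual (Sharp E)) (Flat (Dual E))) ∧
      Nonempty (ABIso (Dual (Flat E)) (Sharp (Dual E)))) := by
  refine ⟨fun E => inferInstance, ⟨fun E => dualIso E, fun E F => dualMap_apply_toLin⟩,
    fun E' E E'' _ _ _ _ _ _ _ _ _ _ _ _ u v hu huv hv =>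
      ⟨dualMap_injective v hv, dualMap_exact u v huv hv, dualMap_surjective u v hu huv hv⟩,
    fun E _ _ _ _ h => (dualIso E).hasSimplePole (hasSimplePole_homAB h),
    fun E => ⟨inferInstance, ⟨dualSharpIso E⟩, ⟨dualFlatIso E⟩⟩⟩
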